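/- Let $I=[a,b]$ with $a<b$, let $\mu$ be uniformly distributed on $I$ with mean $\bar\mu=\frac{a+b}{2}$ and standard deviation $\sigma=\frac{b-a}{2\sqrt3}$, and write $\mu=\bar\mu+\sigma\xi$, so that $\xi$ is uniformly distributed on $I_\xi=[-\sqrt3,\sqrt3]$ with law $\nu_\xi$. Let $\mathbf f:\mathbb R^n\times I\to\mathbb R^n$ be continuous and continuously differentiable in its first argument, i.e. the Jacobian $D_{\mathbf u}\mathbf f$ exists and is continuous on $\mathbb R^n\times I$. Let $\Phi_k$ be the Legendre polynomial of degree $k$ scaled to $I_\xi$ and let $\Pi_N^n=(\mathrm{span}\{\Phi_0,\dots,\Phi_N\})^n$. The PCE-Galerkin problem of degree $N$ is to find $\mathbf u_N\in\Pi_N^n$ such that $$\int_{I_\xi}\langle \mathbf f(\mathbf u_N(z),\bar\mu+\sigma z),\mathbf v(z)\rangle_{\mathbb R^n}\,\mathrm d\nu_\xi(z)=0\qquad\forall\,\mathbf v\in\Pi_N^n .$$ **Theorem (Uniqueness).** Suppose that there is exactly one continuous curve $\mathbf u_*:I\to\mathbb R^n$ with $\mathbf f(\mathbf u_*(\mu),\mu)=\mathbf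 0$ for all $\mu\in I$, and that its re-parametrization $\bar{\mathbf u}(z)=\mathbf u_*(\bar\mu+\sigma z)$ belongs to the Sobolev space $H^s(I_\xi;\mathbb R^n)$ for some real $s>1$. Let $P\in\mathbb R^{n\times n}$ be a constant symmetric positive-definite matrix, $\langle \mathbf v,\mathbf w\rangle_P=\mathbf v^\top P\mathbf w$, $\|\mathbf w\|_P=\sqrt{\langle \mathbf w,\mathbf w\rangle_P}$, and let $\varepsilon\in\{1,-1\}$. Assume that there is $\lambda_{\min}>0$ such that $$\varepsilon\,\langle D_{\mathbf u}\mathbf f(\bar{\mathbf u}(z),\bar\mu+\sigma z)\mathbf w,\mathbf w\rangle_P\ \ge\ \lambda_{\min}\|\mathbf w\|_P^2\qquad\forall z\in I_\xi,\ \forall\,\mathbf w\in\mathbb R^n,$$ and that for every $\rho>0$ there are constants $m_\rho>0$ and $C_\rho>0$ such that, for all $z\in I_\xi$ and all $\mathbf u\in\mathbb R^n$ with $\|\mathbf u-\bar{\mathbf u}(z)\|_P\ge\rho$, $$\varepsilon\,\langle \mathbf f(\mathbf u,\bar\mu+\sigma z),\mathbf u-\bar{\mathbf u}(z)\rangle_P\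 \ge\ m_\rho\|\mathbf u-\bar{\mathbf u}(z)\|_P$$ and $$\|\mathbf f(\mathbf u,\bar\mu+\sigma z)\|_P\ \le\ C_\rho\,\varepsilon\,\langle \mathbf f(\mathbf u,\bar\mu+\sigma z),\mathbf u-\bar{\mathbf u}(z)\rangle_P .$$ Then there exists an integer $\bar N$ such that, for all $N\ge\bar N$, the PCE-Galerkin problem of degree $N$ has exactly one solution $\mathbf u_N\in\Pi_N^n$. -/

import Mathlib

open MeasureTheory Set
open scoped Matrix ContDiff

namespace PCE

/-- The state space `ℝⁿ` with its Euclidean norm. -/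
abbrev State (n : ℕ) := EuclideanSpace ℝ (Fin n)

/-- The reference interval `I_ξ = [-√3, √3]` of the normalized parameter. -/
def Ixi : Set ℝ := Icc (-Real.sqrt 3) (Real.sqrt 3)

/-- The law of `ξ`: the uniform probability measure on `I_ξ`. -/
noncomputable def nuXi : Measure ℝ := ProbabilityTheory.cond volume Ixi

/-- The mean of a parameter uniformly distributed on `[a, b]`. -/
noncomputable def mean (a b : ℝ) : ℝ := (a + b) / 2

/-- The standard deviation of a parameter uniformly distributed on `[a, b]`. -/
noncomputable def std (a b : ℝ) : ℝ := (b - a) / (2 * Real.sqrt 3)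

/-- The re-parametrization `μ = μ̄ + σ z`, mapping `I_ξ` onto `[a, b]`. -/
noncomputable def param (a b z : ℝ) : ℝ := mean a b + std a b * z

/-- The orthogonal polynomial `Φ_k`: the Legendre polynomial `P_k` scaled to `[-√3, √3]`, that is
`Φ_k(z) = P_k(z / √3)`. It is expressed through the shifted Legendre polynomial
(`P_k(x) = (-1)^k * shiftedLegendre k ((1 + x) / 2)`). -/
noncomputable def Phi (k : ℕ) : Polynomial ℝ :=
  (-1) ^ k * ((Polynomial.shiftedLegendre k).map (Int.castRingHom ℝ)).comp
    (Polynomial.C (1 / (2 * Real.sqrt 3)) * Polynomial.X + Polynomial.C (1 / 2))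

/-- The solution and test space `Π_N^n = (span {Φ_0, …, Φ_N})^n`: functions each of whose
components is a linear combination of `Φ_0, …, Φ_N`. -/
noncomputable def polySpace (n N : ℕ) : Submodule ℝ (ℝ → State n) where
  carrier := {u | ∀ i : Fin n, (fun z => u z i) ∈
    Submodule.span ℝ {p : ℝ → ℝ | ∃ k ≤ N, p = fun z => (Phi k).eval z}}
  add_mem' := fun hu hv i => Submodule.add_mem _ (hu i) (hv i)
  zero_mem' := fun _ => Submodule.zero_mem _
  smul_mem' := fun c _ hu i => Submodule.smul_mem _ c (hu i)

/-- `u` solves the PCE-Galerkin problem of degree `N` for the vector field `f` on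
`ℝⁿ × [a, b]`: it lies in `Π_N^n` and its residual is orthogonal to `Π_N^n`. -/
def IsGalerkinSolution {n : ℕ} (f : State n → ℝ → State n) (a b : ℝ) (N : ℕ)
    (u : ℝ → State n) : Prop :=
  u ∈ polySpace n N ∧
    ∀ v ∈ polySpace n N, ∫ z, inner ℝ (f (u z) (param a b z)) (v z) ∂nuXi = 0

/-- `u` is a solution branch of the steady-state problem `f(u(μ), μ) = 0` on `[a, b]`. -/
def IsBranch {n : ℕ} (f : State n → ℝ → State n) (a b : ℝ) (u : ℝ → State n) : Prop :=
  ContinuousOn u (Icc a b) ∧ ∀ μ ∈ Icc a b, f (u μ) μ = 0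

/-- `u` is the unique solution branch of `f(u(μ), μ) = 0` on `[a, b]`. -/
def IsUniqueBranch {n : ℕ} (f : State n → ℝ → State n) (a b : ℝ) (u : ℝ → State n) : Prop :=
  IsBranch f a b u ∧ ∀ w : ℝ → State n, IsBranch f a b w → EqOn w u (Icc a b)

/-- `g` is the `k`-th weak derivative of `u` on the open interval `(c, d)`. -/
def IsWeakDeriv {n : ℕ} (c d : ℝ) (k : ℕ) (u g : ℝ → State n) : Prop :=
  ∀ φ : ℝ → ℝ, ContDiff ℝ ∞ φ → HasCompactSupport φ → tsupport φ ⊆ Ioo c d →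
    ∫ x in Ioo c d, iteratedDeriv k φ x • u x = (-1 : ℝ) ^ k • ∫ x in Ioo c d, φ x • g x

/-- The Sobolev(–Slobodeckij) space `H^s` of real order `s ≥ 0` on the interval `(c, d)`: `u`
is in `L²`, its weak derivatives up to order `m = ⌊s⌋` exist and lie in `L²`, and, if `θ = s - m > 0`, the Gagliardo
seminorm of order `θ` of the `m`-th one is finite. -/
def MemHs {n : ℕ} (c d s : ℝ) (u : ℝ → State n) : Prop :=
  MemLp u 2 (volume.restrict (Ioo c d)) ∧ ∃ D : ℕ → ℝ → State n,
    (∀ k ≤ ⌊s⌋₊, IsWeakDeriv c d k u (D k) ∧ MemLp (D k) 2 (volume.restrict (Ioo c d))) ∧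
    (0 < s - ⌊s⌋₊ →
      ∫⁻ x in Ioo c d, ∫⁻ y in Ioo c d,
        ENNReal.ofReal (‖D ⌊s⌋₊ x - D ⌊s⌋₊ y‖ ^ 2 / |x - y| ^ (1 + 2 * (s - ⌊s⌋₊))) < ⊤)

/-- The weighted inner product `⟨v, w⟩_P = vᵀ P w`. -/
def pInner {n : ℕ} (P : Matrix (Fin n) (Fin n) ℝ) (v w : State n) : ℝ :=
  v.ofLp ⬝ᵥ (P *ᵥ w.ofLp)

/-- The norm `‖v‖_P = √⟨v, v⟩_P`. -/
noncomputable def pNorm {n : ℕ} (P : Matrix (Fin n) (Fin n) ℝ) (v : State n) : ℝ :=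
  Real.sqrt (pInner P v v)

/-- The Jacobian `D_u f(u, μ)`. -/
noncomputable def jac {n : ℕ} (f : State n → ℝ → State n) (u : State n) (μ : ℝ) :
    State n →L[ℝ] State n :=
  fderiv ℝ (fun v => f v μ) u

end PCE

/-!
The proof compares the Galerkin problem with a strongly monotone one.

*Reduction.* A square root `B` of the weight, `⟨Bv, Bw⟩ = ⟨v, w⟩_P`, and the substitution `y = B u`
turn the problem into one for the field `ε B f(B⁻¹ y, μ̄ + σ z)` with the Euclidean inner product
and `ε = 1`; this preserves the Galerkin space because `B` is constant
(`isDiscreteZero_transformedField_iff`).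

*Existence near the root.* Keep the linearization of the field at the root `ubar` and evaluate the
remainder at the radial retraction onto a small ball. By continuity of the Jacobian on a compact
set the resulting field is globally strongly monotone and Lipschitz
(`exists_isMonotoneField_truncField`), so its Galerkin problem has exactly one solution, which is
quasi-optimal in `L²`. It agrees with the given field in a tube around the root.

*Localization.* Any Galerkin solution `u` of the given field lies in the tube
(`norm_sub_le_of_isDiscreteZero`): testing its residual with `u - p`, where `p` is a polynomial
close to the root, bounds the square of the error inside the tube and its first power outside of
it, by the `L²` error of `p`. Hence the solution for the truncated field is the only one.

*Approximation.* Both arguments pass from integral bounds to uniform ones by the inverse inequality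
`‖q‖_∞ ≤ C (N + 1) ‖q‖_{L²}` for polynomials of degree at most `N` (`norm_sq_le_of_mem_polySpace`).
They need approximations of the root with uniform error `o(1)` and `L²` error `o(1 / N)`. As
`s > 1`, the root is a primitive of its square-integrable weak derivative. Integrating the `L²`
projection of the derivative gives the approximation: its uniform error tends to zero by density of
polynomials, and a duality argument gains the factor `1 / N` (`integral_primitive_sq_le`). So only
one square-integrable weak derivative is used, and no estimate of fractional order is needed. The
Jackson and inverse inequalities come from the Legendre equation, the orthogonality of the `Φ_k`
and their norms.
-/

namespace PCE

open Polynomial Filter Topology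

/-! ### Scaled Legendre polynomials -/

lemma coeff_shiftedLegendre_succ (n k : ℕ) :
    ((k : ℝ) + 1) ^ 2 * ((shiftedLegendre n).coeff (k + 1) : ℝ) =
      (k * (k + 1) - n * (n + 1)) * ((shiftedLegendre n).coeff k : ℝ) := by
  have h1 : (n.choose (k + 1) : ℝ) * (k + 1) = n.choose k * (n - k) := by
    rcases le_or_gt k n with h | h
    · have := Nat.choose_succ_right_eq n k
      have h2 : ((n - k : ℕ) : ℝ) = n - k := by push_cast [h]; ring
      rw [← h2]; exact_mod_cast this
    · simp [Nat.choose_eq_zero_of_lt h, Nat.choose_eq_zero_of_lt (h.trans (Nat.lt_succ_self k))]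
  have h2 : (((n + (k + 1)).choose n : ℕ) : ℝ) * (k + 1) = (n + k).choose n * (n + k + 1) := by
    have := Nat.add_one_mul_choose_eq (n + k) k
    have e1 : (n + k).choose n = (n + k).choose k := Nat.choose_symm_add
    have e2 : (n + (k + 1)).choose n = (n + k + 1).choose (k + 1) :=
      Nat.choose_symm_add (a := n) (b := k + 1)
    rw [e1, e2]
    have h3 : ((n + k + 1 : ℕ) : ℝ) * (n + k).choose k = (n + k + 1).choose (k + 1) * (k + 1) := by
      exact_mod_cast this
    rw [← h3]; push_cast; ring
  rw [coeff_shiftedLegendre, coeff_shiftedLegendre]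
  push_cast
  calc ((k : ℝ) + 1) ^ 2 * ((-1) ^ (k + 1) * (n.choose (k + 1)) * ((n + (k + 1)).choose n))
      = -(-1) ^ k * ((n.choose (k + 1) : ℝ) * (k + 1)) *
          ((((n + (k + 1)).choose n : ℕ) : ℝ) * (k + 1)) := by ring
    _ = _ := by rw [h1, h2]; ring

/-- Legendre's differential equation on `[0, 1]`. -/
lemma shiftedLegendre_ode (n : ℕ) :
    derivative ((X - X ^ 2) * derivative ((shiftedLegendre n).map (Int.castRingHom ℝ))) =
      C (-((n : ℝ) * (n + 1))) * (shiftedLegendre n).map (Int.castRingHom ℝ) := by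
  ext k
  have h := coeff_shiftedLegendre_succ n k
  rw [coeff_C_mul, coeff_derivative, sub_mul, coeff_sub, coeff_X_mul, coeff_derivative]
  have hX : (X ^ 2 * derivative ((shiftedLegendre n).map (Int.castRingHom ℝ))).coeff (k + 1) =
      k * ((shiftedLegendre n).coeff k : ℝ) := by
    rw [pow_two, mul_assoc, coeff_X_mul]
    cases k with
    | zero => simp
    | succ k => rw [coeff_X_mul, coeff_derivative]; simp; ring
  rw [hX]
  simp only [coeff_map, eq_intCast]
  linear_combination h

/-- The affine map carrying `[-√3, √3]` onto `[0, 1]`. -/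
noncomputable def unitAffine : ℝ[X] := C (1 / (2 * Real.sqrt 3)) * X + C (1 / 2)

lemma sqrt_three_pos : 0 < Real.sqrt 3 := by positivity

lemma sqrt_three_sq : Real.sqrt 3 ^ 2 = 3 := Real.sq_sqrt (by norm_num)

lemma Phi_def (k : ℕ) :
    Phi k = (-1) ^ k * ((shiftedLegendre k).map (Int.castRingHom ℝ)).comp unitAffine := rfl

lemma natDegree_Phi (k : ℕ) : (Phi k).natDegree = k := by
  have h1 : unitAffine.natDegree = 1 := natDegree_linear (by positivity)
  have h2 : ((-1 : ℝ[X]) ^ k) = C ((-1) ^ k) := by simp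
  rw [Phi_def, h2, natDegree_C_mul (by simp), natDegree_comp, h1, mul_one,
    natDegree_map_eq_of_injective (RingHom.injective_int _), natDegree_shiftedLegendre]

lemma Phi_ne_zero (k : ℕ) : Phi k ≠ 0 := by
  intro h
  rcases Nat.eq_zero_or_pos k with rfl | hk
  · have h2 : (shiftedLegendre 0) = 1 := by simp [shiftedLegendre]
    simp [Phi_def, h2] at h
  · have := natDegree_Phi k
    rw [h] at this; simp at this; omega

lemma eval_Phi_sqrt_three_sq (k : ℕ) : (Phi k).eval (Real.sqrt 3) ^ 2 = 1 := by
  have h0 := shiftedLegendre_eval_symm k (1 : ℝ)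
  have h1 : aeval (0 : ℝ) (shiftedLegendre k) = 1 := by
    rw [← coeff_zero_eq_aeval_zero']; simp [coeff_shiftedLegendre]
  have h2 : unitAffine.eval (Real.sqrt 3) = 1 := by
    have := sqrt_three_pos.ne'
    simp [unitAffine]; field_simp; norm_num
  rw [sub_self, h1] at h0
  rw [Phi_def]
  simp only [eval_mul, eval_pow, eval_neg, eval_one, eval_comp, h2]
  rw [eval_map, ← algebraMap_int_eq, ← aeval_def, h0, mul_one, ← mul_pow]
  simp

lemma eval_Phi_neg_sqrt_three_sq (k : ℕ) : (Phi k).eval (-Real.sqrt 3) ^ 2 = 1 := by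
  have h1 : aeval (0 : ℝ) (shiftedLegendre k) = 1 := by
    rw [← coeff_zero_eq_aeval_zero']; simp [coeff_shiftedLegendre]
  have h2 : unitAffine.eval (-Real.sqrt 3) = 0 := by
    have := sqrt_three_pos.ne'
    simp [unitAffine]; field_simp; norm_num
  rw [Phi_def]
  simp only [eval_mul, eval_pow, eval_neg, eval_one, eval_comp, h2]
  rw [eval_map, ← algebraMap_int_eq, ← aeval_def, h1]
  simp [← pow_mul]

/-- The Legendre operator `p ↦ -((3 - X²) p')'` on `[-√3, √3]`. -/
noncomputable def legendreOp : ℝ[X] →ₗ[ℝ] ℝ[X] :=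
  -(derivative ∘ₗ LinearMap.mulLeft ℝ (3 - X ^ 2) ∘ₗ derivative)

lemma legendreOp_apply (p : ℝ[X]) :
    legendreOp p = -derivative ((3 - X ^ 2) * derivative p) := rfl

lemma legendreOp_Phi (k : ℕ) : legendreOp (Phi k) = ((k : ℝ) * (k + 1)) • Phi k := by
  set L := (shiftedLegendre k).map (Int.castRingHom ℝ) with hL
  set c : ℝ := 1 / (2 * Real.sqrt 3) with hc
  have hc2 : 12 * c ^ 2 = 1 := by
    rw [hc, div_pow, mul_pow, sqrt_three_sq]; norm_num
  have hd : derivative unitAffine = C c := by simp [unitAffine, hc]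
  have h2 : ((-1 : ℝ[X]) ^ k) = C ((-1) ^ k) := by simp
  have hcomp : (3 - X ^ 2 : ℝ[X]) = C 12 * (X - X ^ 2 : ℝ[X]).comp unitAffine := by
    have h3 : (X - X ^ 2 : ℝ[X]).comp unitAffine = C (1 / 4) - C (c ^ 2) * X ^ 2 := by
      have : (C (1 / 4) : ℝ[X]) = C (1 / 2) - C (1 / 2) ^ 2 := by
        rw [← C_pow, ← C_sub]; norm_num
      have h5 : (2 * C (1 / 2) : ℝ[X]) = 1 := by
        rw [show (2 : ℝ[X]) = C 2 from rfl, ← C_mul]; norm_num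
      simp only [unitAffine, ← hc, sub_comp, pow_comp, X_comp, this, C_pow]
      linear_combination (-(C c * X)) * h5
    rw [h3, mul_sub, ← mul_assoc, ← C_mul, ← C_mul, hc2]
    norm_num
    rfl
  have hode := congrArg (fun p : ℝ[X] => p.comp unitAffine) (shiftedLegendre_ode k)
  simp only [← hL, mul_comp, C_comp] at hode
  have key : (3 - X ^ 2) * derivative (Phi k) =
      C ((-1) ^ k * 12 * c) * ((X - X ^ 2) * derivative L).comp unitAffine := by
    rw [Phi_def, ← hL, h2, derivative_C_mul, derivative_comp, hd, hcomp]
    simp only [C_mul, mul_comp]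
    ring
  rw [legendreOp_apply, key, derivative_C_mul, derivative_comp, hd, hode, Phi_def, ← hL, h2,
    smul_eq_C_mul]
  have : (C ((-1) ^ k * 12 * c) * C c : ℝ[X]) = C ((-1) ^ k) := by
    rw [← C_mul]; congr 1; linear_combination (-1) ^ k * hc2
  simp only [C_neg]
  linear_combination (C (k * (k + 1 : ℝ)) * L.comp unitAffine) * this

/-! ### The integral of a polynomial over the reference interval -/

/-- The linear functional `p ↦ ∫ p` over `[-√3, √3]`. -/
noncomputable def polyInt : ℝ[X] →ₗ[ℝ] ℝ where
  toFun p := ∫ z in (-Real.sqrt 3)..(Real.sqrt 3), p.eval z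
  map_add' p q := by
    simp only [eval_add]
    exact intervalIntegral.integral_add (p.continuous.intervalIntegrable _ _)
      (q.continuous.intervalIntegrable _ _)
  map_smul' c p := by
    simp only [eval_smul, smul_eq_mul, RingHom.id_apply]
    exact intervalIntegral.integral_const_mul _ _

lemma polyInt_apply (p : ℝ[X]) :
    polyInt p = ∫ z in (-Real.sqrt 3)..(Real.sqrt 3), p.eval z := rfl

lemma integral_eval_derivative (p : ℝ[X]) (x y : ℝ) :
    ∫ z in x..y, (derivative p).eval z = p.eval y - p.eval x :=
  intervalIntegral.integral_eq_sub_of_hasDerivAt (fun z _ => p.hasDerivAt z)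
    ((derivative p).continuous.intervalIntegrable _ _)

lemma polyInt_derivative (p : ℝ[X]) :
    polyInt (derivative p) = p.eval (Real.sqrt 3) - p.eval (-Real.sqrt 3) :=
  integral_eval_derivative p _ _

lemma polyInt_nonneg {p : ℝ[X]} (hp : ∀ z ∈ Ixi, 0 ≤ p.eval z) : 0 ≤ polyInt p :=
  intervalIntegral.integral_nonneg (by linarith [sqrt_three_pos]) hp

lemma polyInt_mul_self_nonneg (p : ℝ[X]) : 0 ≤ polyInt (p * p) :=
  polyInt_nonneg fun z _ => by rw [eval_mul]; exact mul_self_nonneg _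

lemma polyInt_legendreOp_mul (p q : ℝ[X]) :
    polyInt (legendreOp p * q) = polyInt ((3 - X ^ 2) * derivative p * derivative q) := by
  have h := polyInt_derivative ((3 - X ^ 2) * derivative p * q)
  have h0 : (3 - X ^ 2 : ℝ[X]).eval (Real.sqrt 3) = 0 := by
    simp [show (3 : ℝ[X]) = C 3 from rfl]
  have h1 : (3 - X ^ 2 : ℝ[X]).eval (-Real.sqrt 3) = 0 := by
    simp [show (3 : ℝ[X]) = C 3 from rfl]
  rw [eval_mul, eval_mul, h0, eval_mul, eval_mul, h1, derivative_mul, map_add] at h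
  rw [legendreOp_apply, neg_mul, map_neg]
  linarith

lemma polyInt_Phi_mul_Phi {j k : ℕ} (hjk : j ≠ k) : polyInt (Phi j * Phi k) = 0 := by
  have h1 := polyInt_legendreOp_mul (Phi j) (Phi k)
  have h2 := polyInt_legendreOp_mul (Phi k) (Phi j)
  rw [legendreOp_Phi, smul_mul_assoc, map_smul, smul_eq_mul] at h1 h2
  rw [mul_comm (Phi k) (Phi j), mul_right_comm (3 - X ^ 2 : ℝ[X])] at h2
  have h3 : ((j : ℝ) * (j + 1) - k * (k + 1)) * polyInt (Phi j * Phi k) = 0 := by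
    rw [sub_mul, h1, h2, sub_self]
  rcases mul_eq_zero.1 h3 with h | h
  · exfalso
    have h4 : ((j : ℝ) - k) * (j + k + 1) = 0 := by linear_combination h
    rcases mul_eq_zero.1 h4 with h | h
    · exact hjk (by exact_mod_cast sub_eq_zero.1 h)
    · have : (0 : ℝ) ≤ j := by positivity
      have : (0 : ℝ) ≤ k := by positivity
      linarith
  · exact h

lemma exists_eq_sum_Phi {p : ℝ[X]} {N : ℕ} (hp : p.natDegree ≤ N) :
    ∃ a : ℕ → ℝ, p = ∑ k ∈ Finset.range (N + 1), a k • Phi k := by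
  let S : Polynomial.Sequence ℝ :=
    ⟨Phi, fun i => by rw [degree_eq_natDegree (Phi_ne_zero i), natDegree_Phi]⟩
  have h := S.span_degreeLE (m := N) fun i _ =>
    (leadingCoeff_ne_zero.2 (Phi_ne_zero i)).isUnit
  have hmem : p ∈ Submodule.span ℝ (Phi '' (Finset.range (N + 1) : Set ℕ)) := by
    have : (Finset.range (N + 1) : Set ℕ) = Iic N := by ext; simp
    rw [this]
    change p ∈ Submodule.span ℝ (S '' Iic N)
    rw [h, mem_degreeLE]
    exact natDegree_le_iff_degree_le.1 hp
  obtain ⟨a, ha⟩ := (Submodule.mem_span_image_finset_iff_exists_fun ℝ).1 hmem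
  refine ⟨fun n => if h : n ∈ Finset.range (N + 1) then a ⟨n, h⟩ else 0, ?_⟩
  rw [← ha, ← Finset.sum_coe_sort (Finset.range (N + 1))]
  exact Finset.sum_congr rfl fun i _ => by beta_reduce; rw [dif_pos i.2]

lemma polyInt_Phi_mul_of_natDegree_lt {p : ℝ[X]} {k : ℕ} (hp : p.natDegree < k) :
    polyInt (Phi k * p) = 0 := by
  obtain ⟨a, ha⟩ := exists_eq_sum_Phi (N := k - 1) (p := p) (by omega)
  rw [ha, Finset.mul_sum, map_sum]
  refine Finset.sum_eq_zero fun j hj => ?_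
  have : k ≠ j := by have := Finset.mem_range.1 hj; omega
  rw [mul_smul_comm, map_smul, polyInt_Phi_mul_Phi this, smul_zero]

/-- The `L²` norm of `Φ_k`: integrate `(z Φ_k²)'` and use that `z Φ_k' - k Φ_k` has degree less
than `k`. -/
lemma polyInt_Phi_sq (k : ℕ) : (2 * (k : ℝ) + 1) * polyInt (Phi k * Phi k) = 2 * Real.sqrt 3 := by
  have h := polyInt_derivative (X * (Phi k * Phi k))
  have e1 := eval_Phi_sqrt_three_sq k
  have e2 := eval_Phi_neg_sqrt_three_sq k
  rw [pow_two] at e1 e2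
  simp only [eval_mul, eval_X, e1, e2] at h
  have hlow : polyInt (Phi k * (X * derivative (Phi k) - C (k : ℝ) * Phi k)) = 0 := by
    rcases Nat.eq_zero_or_pos k with rfl | hk
    · have : derivative (Phi 0) = 0 :=
        derivative_of_natDegree_zero (natDegree_Phi 0)
      simp [this]
    · apply polyInt_Phi_mul_of_natDegree_lt
      rw [← Nat.le_sub_one_iff_lt hk, natDegree_le_iff_coeff_eq_zero]
      intro m hm
      obtain ⟨m, rfl⟩ : ∃ m', m = m' + 1 := ⟨m - 1, by omega⟩
      rw [coeff_sub, coeff_X_mul, coeff_derivative, coeff_C_mul]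
      rcases (show k ≤ m + 1 by omega).eq_or_lt with h | h
      · rw [h]; push_cast; ring
      · rw [coeff_eq_zero_of_natDegree_lt (by rw [natDegree_Phi]; exact h)]; ring
  have h3 : derivative (X * (Phi k * Phi k)) = (2 * (k : ℝ) + 1) • (Phi k * Phi k) +
      (2 : ℝ) • (Phi k * (X * derivative (Phi k) - C (k : ℝ) * Phi k)) := by
    simp only [derivative_mul, derivative_X, smul_eq_C_mul, C_add, C_mul, C_1]
    rw [show (C 2 : ℝ[X]) = 2 from rfl]
    ring
  rw [h3, map_add, map_smul, map_smul, hlow] at h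
  simp only [smul_eq_mul] at h
  linarith

lemma polyInt_Phi_sq_eq (k : ℕ) :
    polyInt (Phi k * Phi k) = 2 * Real.sqrt 3 / (2 * (k : ℝ) + 1) := by
  rw [eq_div_iff (by positivity), mul_comm]; exact polyInt_Phi_sq k

lemma polyInt_sum_mul_sum (s : Finset ℕ) (a b : ℕ → ℝ) :
    polyInt ((∑ k ∈ s, a k • Phi k) * ∑ k ∈ s, b k • Phi k) =
      ∑ k ∈ s, a k * b k * polyInt (Phi k * Phi k) := by
  rw [Finset.sum_mul_sum, map_sum]
  refine Finset.sum_congr rfl fun i hi => ?_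
  rw [map_sum, Finset.sum_eq_single_of_mem i hi]
  · simp only [smul_mul_smul_comm, map_smul, smul_eq_mul]
  · intro j _ hj
    rw [smul_mul_smul_comm, map_smul, polyInt_Phi_mul_Phi hj.symm, smul_zero]

/-! ### Inverse inequality and Jackson inequality -/

lemma eval_sqrt_three_sq_le {p : ℝ[X]} {N : ℕ} (hp : p.natDegree ≤ N) :
    2 * Real.sqrt 3 * p.eval (Real.sqrt 3) ^ 2 ≤ ((N : ℝ) + 1) ^ 2 * polyInt (p * p) := by
  obtain ⟨a, rfl⟩ := exists_eq_sum_Phi hp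
  have hS := sqrt_three_pos
  rw [polyInt_sum_mul_sum, eval_finsetSum]
  have hodd : ∑ k ∈ Finset.range (N + 1), (2 * (k : ℝ) + 1) = ((N : ℝ) + 1) ^ 2 := by
    induction N with
    | zero => simp
    | succ N ih => rw [Finset.sum_range_succ, ih (by
        refine natDegree_sum_le_of_forall_le _ _ fun i hi => ?_
        refine (natDegree_smul_le _ _).trans ?_
        rw [natDegree_Phi]; have := Finset.mem_range.1 hi; omega)]; push_cast; ring
  have h := Finset.sum_sq_le_sum_mul_sum_of_sq_le_mul (Finset.range (N + 1))
    (r := fun k => (a k • Phi k).eval (Real.sqrt 3)) (f := fun k : ℕ => 2 * (k : ℝ) + 1)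
    (g := fun k => a k * a k * polyInt (Phi k * Phi k) / (2 * Real.sqrt 3))
    (fun i _ => by positivity)
    (fun i _ => div_nonneg (mul_nonneg (mul_self_nonneg _) (polyInt_mul_self_nonneg _))
      (by positivity))
    (fun i _ => by
      rw [polyInt_Phi_sq_eq, eval_smul, smul_eq_mul, mul_pow, eval_Phi_sqrt_three_sq]
      apply le_of_eq
      field_simp)
  rw [hodd, ← Finset.sum_div] at h
  calc _ ≤ 2 * Real.sqrt 3 * (((N : ℝ) + 1) ^ 2 * ((∑ k ∈ Finset.range (N + 1),
        a k * a k * polyInt (Phi k * Phi k)) / (2 * Real.sqrt 3))) := by gcongr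
    _ = _ := by field_simp

/-- Rescaling `[-√3, y]` to `[-√3, √3]` gives the endpoint estimate on every subinterval that is
at least half as long. -/
lemma eval_sq_le_of_nonneg {p : ℝ[X]} {N : ℕ} (hp : p.natDegree ≤ N) {y : ℝ} (hy : 0 ≤ y)
    (hy2 : y ≤ Real.sqrt 3) :
    Real.sqrt 3 * p.eval y ^ 2 ≤ ((N : ℝ) + 1) ^ 2 * polyInt (p * p) := by
  have hS := sqrt_three_pos
  set S := Real.sqrt 3 with hSdef
  set c : ℝ := (y + S) / (2 * S) with hc
  have hc0 : 0 < c := by positivity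
  have hc2 : 1 ≤ 2 * c := by
    rw [hc, ← mul_div_assoc, le_div_iff₀ (by positivity)]; linarith
  set ℓ : ℝ[X] := C c * X + C (c * S - S) with hℓ
  have hcS : c * (2 * S) = y + S := by rw [hc]; field_simp
  have hdeg : (p.comp ℓ).natDegree ≤ N := by
    rw [natDegree_comp, natDegree_linear hc0.ne', mul_one]; exact hp
  have h1 := eval_sqrt_three_sq_le hdeg
  have h2 : (p.comp ℓ).eval S = p.eval y := by
    rw [eval_comp]; congr 1; simp [hℓ]; linarith
  have h3 : polyInt (p.comp ℓ * p.comp ℓ) = c⁻¹ * ∫ z in (-S)..y, (p * p).eval z := by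
    rw [← mul_comp, polyInt_apply, ← hSdef]
    have := intervalIntegral.integral_comp_mul_add (a := -S) (b := S) (fun z => (p * p).eval z)
      hc0.ne' (c * S - S)
    have e1 : c * -S + (c * S - S) = -S := by ring
    have e2 : c * S + (c * S - S) = y := by linarith
    rw [e1, e2, smul_eq_mul] at this
    rw [← this]
    simp [hℓ, eval_comp]
  have h4 : ∫ z in (-S)..y, (p * p).eval z ≤ polyInt (p * p) := by
    rw [polyInt_apply, ← hSdef,
      ← intervalIntegral.integral_add_adjacent_intervals (a := -S) (b := y) (c := S)
      ((p * p).continuous.intervalIntegrable _ _) ((p * p).continuous.intervalIntegrable _ _)]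
    have : 0 ≤ ∫ z in y..S, (p * p).eval z :=
      intervalIntegral.integral_nonneg hy2 fun z _ => by rw [eval_mul]; exact mul_self_nonneg _
    linarith
  rw [← hSdef, h2, h3] at h1
  have h6 : c⁻¹ ≤ 2 := by
    rw [inv_le_iff_one_le_mul₀ hc0]; linarith
  have h7 : c⁻¹ * ∫ z in (-S)..y, (p * p).eval z ≤ 2 * polyInt (p * p) :=
    mul_le_mul h6 h4 (intervalIntegral.integral_nonneg (by linarith)
      fun z _ => by rw [eval_mul]; exact mul_self_nonneg _) (by norm_num)
  have h8 : ((N : ℝ) + 1) ^ 2 * (c⁻¹ * ∫ z in (-S)..y, (p * p).eval z) ≤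
      ((N : ℝ) + 1) ^ 2 * (2 * polyInt (p * p)) := by gcongr
  linarith

/-- The inverse inequality: on polynomials of degree at most `N` the sup norm is bounded by
`N + 1` times the `L²` norm, up to a constant. -/
lemma eval_sq_le {p : ℝ[X]} {N : ℕ} (hp : p.natDegree ≤ N) {y : ℝ} (hy : y ∈ Ixi) :
    Real.sqrt 3 * p.eval y ^ 2 ≤ ((N : ℝ) + 1) ^ 2 * polyInt (p * p) := by
  rcases le_total 0 y with h | h
  · exact eval_sq_le_of_nonneg hp h hy.2
  · have hdeg : (p.comp (-X)).natDegree ≤ N := by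
      rw [natDegree_comp, natDegree_neg, natDegree_X, mul_one]; exact hp
    have h1 := eval_sq_le_of_nonneg hdeg (y := -y) (by linarith) (by linarith [hy.1])
    have h2 : polyInt (p.comp (-X) * p.comp (-X)) = polyInt (p * p) := by
      rw [← mul_comp, polyInt_apply, polyInt_apply]
      have := intervalIntegral.integral_comp_neg (a := -Real.sqrt 3) (b := Real.sqrt 3)
        (fun z => (p * p).eval z)
      rw [neg_neg] at this
      rw [← this]
      simp [eval_comp]
    rw [h2] at h1
    simpa [eval_comp] using h1

/-- The Jackson inequality for polynomials, with a constant independent of the degree of `w`: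
truncating the Legendre expansion of `w` after degree `N` costs at most
`((N + 1) (N + 2))⁻¹ ⟨w, legendreOp w⟩` in squared norm. -/
lemma exists_polyInt_sub_sq_le (w : ℝ[X]) (N : ℕ) :
    ∃ q : ℝ[X], q.natDegree ≤ N ∧
      ((N : ℝ) + 1) ^ 2 * polyInt ((w - q) * (w - q)) ≤
        3 * polyInt (derivative w * derivative w) := by
  obtain ⟨a, ha⟩ := exists_eq_sum_Phi (le_refl w.natDegree)
  set s := Finset.range (w.natDegree + 1)
  refine ⟨∑ k ∈ s with k ≤ N, a k • Phi k, ?_, ?_⟩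
  · refine natDegree_sum_le_of_forall_le _ _ fun i hi => ?_
    refine (natDegree_smul_le _ _).trans ?_
    rw [natDegree_Phi]; exact (Finset.mem_filter.1 hi).2
  have hsub : w - ∑ k ∈ s with k ≤ N, a k • Phi k = ∑ k ∈ s with ¬ k ≤ N, a k • Phi k := by
    conv_lhs => rw [ha]
    rw [← Finset.sum_filter_add_sum_filter_not s (fun k => k ≤ N), add_sub_cancel_left]
  have hop : legendreOp w = ∑ k ∈ s, (a k * ((k : ℝ) * (k + 1))) • Phi k := by
    conv_lhs => rw [ha]
    rw [map_sum]
    exact Finset.sum_congr rfl fun k _ => by rw [map_smul, legendreOp_Phi, smul_smul]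
  have henergy : polyInt ((3 - X ^ 2) * derivative w * derivative w) =
      ∑ k ∈ s, (a k * ((k : ℝ) * (k + 1))) * a k * polyInt (Phi k * Phi k) := by
    rw [← polyInt_legendreOp_mul, ← polyInt_sum_mul_sum, ← hop, ← ha]
  have hterm : ∀ k : ℕ, 0 ≤ a k * a k * polyInt (Phi k * Phi k) := fun k =>
    mul_nonneg (mul_self_nonneg _) (polyInt_mul_self_nonneg _)
  have h1 : polyInt ((3 - X ^ 2) * derivative w * derivative w) ≤
      3 * polyInt (derivative w * derivative w) := by
    have h := polyInt_nonneg (p := X ^ 2 * (derivative w * derivative w)) fun z _ => by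
      rw [eval_mul, eval_mul]
      exact mul_nonneg (by simpa using sq_nonneg z) (mul_self_nonneg _)
    have e : (3 - X ^ 2) * derivative w * derivative w =
        (3 : ℝ) • (derivative w * derivative w) - X ^ 2 * (derivative w * derivative w) := by
      rw [smul_eq_C_mul, show (C 3 : ℝ[X]) = 3 from rfl]; ring
    rw [e, map_sub, map_smul, smul_eq_mul]
    linarith
  refine le_trans ?_ h1
  rw [hsub, polyInt_sum_mul_sum, henergy, Finset.mul_sum]
  calc _ ≤ ∑ k ∈ s with ¬ k ≤ N,
        (a k * ((k : ℝ) * (k + 1))) * a k * polyInt (Phi k * Phi k) := by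
        refine Finset.sum_le_sum fun k hk => ?_
        have hk' : (N : ℝ) + 1 ≤ k := by exact_mod_cast not_le.1 (Finset.mem_filter.1 hk).2
        have h2 : ((N : ℝ) + 1) ^ 2 ≤ k * (k + 1) := by
          have : (0 : ℝ) ≤ N := by positivity
          nlinarith
        calc _ ≤ ((k : ℝ) * (k + 1)) * (a k * a k * polyInt (Phi k * Phi k)) :=
              mul_le_mul_of_nonneg_right h2 (hterm k)
          _ = _ := by ring
    _ ≤ _ := Finset.sum_le_sum_of_subset_of_nonneg (Finset.filter_subset _ _) fun k _ _ => by
        have := mul_nonneg (show (0 : ℝ) ≤ (k : ℝ) * (k + 1) by positivity) (hterm k)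
        calc (0 : ℝ) ≤ _ := this
          _ = _ := by ring

/-! ### Weak derivatives and the fundamental theorem of calculus -/

/-- A smooth step from `0` to `1` located on `[x, x + 1 / (k + 1)]`. -/
noncomputable def smoothStep (k : ℕ) (x t : ℝ) : ℝ :=
  Real.smoothTransition (((k : ℝ) + 1) * (t - x))

lemma contDiff_smoothStep (k : ℕ) (x : ℝ) : ContDiff ℝ ∞ (smoothStep k x) := by
  unfold smoothStep
  exact Real.smoothTransition.contDiff.comp (by fun_prop)

lemma smoothStep_of_le {k : ℕ} {x t : ℝ} (h : t ≤ x) : smoothStep k x t = 0 :=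
  Real.smoothTransition.zero_of_nonpos (mul_nonpos_of_nonneg_of_nonpos (by positivity)
    (by linarith))

lemma smoothStep_of_ge {k : ℕ} {x t : ℝ} (h : x + 1 / ((k : ℝ) + 1) ≤ t) :
    smoothStep k x t = 1 := by
  refine Real.smoothTransition.one_of_one_le ?_
  have hk : (0 : ℝ) < (k : ℝ) + 1 := by positivity
  have h1 : 1 / ((k : ℝ) + 1) ≤ t - x := by linarith
  rw [div_le_iff₀ hk] at h1
  linarith

lemma deriv_smoothStep (k : ℕ) (x t : ℝ) :
    deriv (smoothStep k x) t =
      ((k : ℝ) + 1) * deriv Real.smoothTransition (((k : ℝ) + 1) * (t - x)) := by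
  have h1 : HasDerivAt (fun t : ℝ => ((k : ℝ) + 1) * (t - x)) ((k : ℝ) + 1) t := by
    simpa using ((hasDerivAt_id t).sub_const x).const_mul ((k : ℝ) + 1)
  have h2 : DifferentiableAt ℝ Real.smoothTransition (((k : ℝ) + 1) * (t - x)) :=
    (Real.smoothTransition.contDiff (n := 1)).differentiable (by norm_num) _
  rw [mul_comm]
  exact (h2.hasDerivAt.comp t h1).deriv

lemma hasCompactSupport_deriv_smoothTransition :
    HasCompactSupport (deriv Real.smoothTransition) := by
  refine HasCompactSupport.intro (isCompact_Icc (a := (0 : ℝ)) (b := 1)) fun t ht => ?_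
  rw [mem_Icc, not_and_or, not_le, not_le] at ht
  rcases ht with ht | ht
  · have : Real.smoothTransition =ᶠ[𝓝 t] fun _ => 0 := by
      filter_upwards [Iio_mem_nhds ht] with s hs
      exact Real.smoothTransition.zero_of_nonpos (le_of_lt hs)
    rw [this.deriv_eq]; simp
  · have : Real.smoothTransition =ᶠ[𝓝 t] fun _ => 1 := by
      filter_upwards [Ioi_mem_nhds ht] with s hs
      exact Real.smoothTransition.one_of_one_le (le_of_lt hs)
    rw [this.deriv_eq]; simp

lemma continuous_deriv_smoothTransition : Continuous (deriv Real.smoothTransition) :=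
  (Real.smoothTransition.contDiff (n := 1)).continuous_deriv (by norm_num)

lemma integrable_deriv_smoothTransition : Integrable (deriv Real.smoothTransition) :=
  continuous_deriv_smoothTransition.integrable_of_hasCompactSupport
    hasCompactSupport_deriv_smoothTransition

lemma integral_deriv_smoothTransition : ∫ t, deriv Real.smoothTransition t = 1 := by
  have h := integral_of_hasDerivAt_of_tendsto (f := Real.smoothTransition)
    (f' := deriv Real.smoothTransition) (m := 0) (n := 1)
    (fun x => ((Real.smoothTransition.contDiff (n := 1)).differentiable (by norm_num) x).hasDerivAt)
    integrable_deriv_smoothTransition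
    (tendsto_const_nhds.congr' (by
      filter_upwards [eventually_le_atBot (0 : ℝ)] with t ht
      exact (Real.smoothTransition.zero_of_nonpos ht).symm))
    (tendsto_const_nhds.congr' (by
      filter_upwards [eventually_ge_atTop (1 : ℝ)] with t ht
      exact (Real.smoothTransition.one_of_one_le ht).symm))
  simpa using h

section ApproximateIdentity

variable {E : Type*} [NormedAddCommGroup E] [NormedSpace ℝ E]

lemma integrable_deriv_smoothStep_smul {w : ℝ → E} {M : ℝ} (hM : ∀ t, ‖w t‖ ≤ M)
    (hw : AEStronglyMeasurable w) (k : ℕ) (x : ℝ) :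
    Integrable fun t => deriv (smoothStep k x) t • w t := by
  have h1 : Integrable fun t => deriv (smoothStep k x) t := by
    simp only [deriv_smoothStep]
    have := (integrable_deriv_smoothTransition.comp_mul_left'
      (show ((k : ℝ) + 1) ≠ 0 by positivity)).comp_sub_right x
    exact this.const_mul _
  exact h1.smul_bdd M hw (ae_of_all _ hM)

/-- The derivatives of the smooth steps at `x` form an approximate identity at `x`. -/
lemma tendsto_integral_deriv_smoothStep_smul [CompleteSpace E] {w : ℝ → E} {M : ℝ}
    (hM : ∀ t, ‖w t‖ ≤ M) (hw : StronglyMeasurable w) {x : ℝ} (hx : ContinuousAt w x) :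
    Tendsto (fun k : ℕ => ∫ t, deriv (smoothStep k x) t • w t) atTop (𝓝 (w x)) := by
  have hsub : ∀ k : ℕ, ∫ t, deriv (smoothStep k x) t • w t =
      ∫ s, deriv Real.smoothTransition s • w (x + ((k : ℝ) + 1)⁻¹ * s) := by
    intro k
    have hk : (0 : ℝ) < (k : ℝ) + 1 := by positivity
    set G : ℝ → E := fun s => deriv Real.smoothTransition s • w (x + ((k : ℝ) + 1)⁻¹ * s) with hG
    have h1 := Measure.integral_comp_mul_left G ((k : ℝ) + 1)
    have h2 := integral_sub_right_eq_self (μ := volume) (fun t => G (((k : ℝ) + 1) * t)) x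
    rw [h1, abs_of_pos (inv_pos.2 hk)] at h2
    have h3 : ∫ t, deriv (smoothStep k x) t • w t =
        ((k : ℝ) + 1) • ∫ t, G (((k : ℝ) + 1) * (t - x)) := by
      rw [← integral_smul]
      refine integral_congr_ae (ae_of_all _ fun t => ?_)
      simp only [hG, deriv_smoothStep]
      rw [smul_smul]
      congr 2
      field_simp
      ring
    rw [h3, h2, smul_inv_smul₀ hk.ne']
  simp only [hsub]
  have hlim : ∫ s, deriv Real.smoothTransition s • w x = w x := by
    rw [integral_smul_const, integral_deriv_smoothTransition, one_smul]
  conv => rhs; rw [← hlim]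
  refine tendsto_integral_of_dominated_convergence
    (fun s => ‖deriv Real.smoothTransition s‖ * M) (fun k => ?_)
    (integrable_deriv_smoothTransition.norm.mul_const M)
    (fun k => ae_of_all _ fun s => ?_) (ae_of_all _ fun s => ?_)
  · exact continuous_deriv_smoothTransition.aestronglyMeasurable.smul
      (hw.comp_measurable (by fun_prop)).aestronglyMeasurable
  · rw [norm_smul]; gcongr; exact hM _
  · refine Tendsto.const_smul ?_ _
    refine hx.tendsto.comp ?_
    have h1 : Tendsto (fun k : ℕ => ((k : ℝ) + 1)⁻¹) atTop (𝓝 0) := by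
      simpa [one_div] using tendsto_one_div_add_atTop_nhds_zero_nat (𝕜 := ℝ)
    simpa using (h1.mul_const s).const_add x

end ApproximateIdentity

/-- A continuous function with an integrable weak derivative is a primitive of it, at interior
points: test the weak derivative against smooth approximations of the indicator of `(x, y]`. -/
lemma IsWeakDeriv.sub_eq_integral_of_mem_Ioo {n : ℕ} {c d : ℝ} {u g : ℝ → State n}
    (hu : ContinuousOn u (Icc c d)) (hg : IntegrableOn g (Ioo c d)) (h : IsWeakDeriv c d 1 u g)
    {x y : ℝ} (hx : x ∈ Ioo c d) (hy : y ∈ Ioo c d) (hxy : x ≤ y) :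
    u y - u x = ∫ t in x..y, g t := by
  obtain ⟨M, hM⟩ := isCompact_Icc.exists_bound_of_continuousOn hu
  have hM0 : 0 ≤ M := (norm_nonneg _).trans (hM x (Ioo_subset_Icc_self hx))
  set w : ℝ → State n := (Ioo c d).indicator u with hw
  have hwM : ∀ t, ‖w t‖ ≤ M := by
    intro t
    by_cases ht : t ∈ Ioo c d
    · rw [hw, indicator_of_mem ht]; exact hM t (Ioo_subset_Icc_self ht)
    · rw [hw, indicator_of_notMem ht, norm_zero]; exact hM0
  have hwm : StronglyMeasurable w := by
    classical
    rw [hw, ← piecewise_eq_indicator]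
    exact ((hu.mono Ioo_subset_Icc_self).measurable_piecewise continuousOn_const
      measurableSet_Ioo).stronglyMeasurable
  have hcont : ∀ z ∈ Ioo c d, ContinuousAt w z := fun z hz =>
    (hu.continuousAt (Icc_mem_nhds hz.1 hz.2)).congr (by
      filter_upwards [Ioo_mem_nhds hz.1 hz.2] with t ht
      rw [hw, indicator_of_mem ht])
  set φ : ℕ → ℝ → ℝ := fun k => smoothStep k x - smoothStep k y with hφ
  have hφd : ∀ k t, deriv (φ k) t = deriv (smoothStep k x) t - deriv (smoothStep k y) t :=
    fun k t => deriv_sub ((contDiff_smoothStep k x).differentiable (by simp) t)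
      ((contDiff_smoothStep k y).differentiable (by simp) t)
  have hφ0 : ∀ (k : ℕ) (t : ℝ), t ∉ Icc x (y + 1 / ((k : ℝ) + 1)) → φ k t = 0 := by
    intro k t ht
    have hk : 0 < 1 / ((k : ℝ) + 1) := by positivity
    rw [mem_Icc, not_and_or, not_le, not_le] at ht
    simp only [hφ, Pi.sub_apply]
    rcases ht with ht | ht
    · rw [smoothStep_of_le ht.le, smoothStep_of_le (ht.le.trans hxy), sub_self]
    · rw [smoothStep_of_ge ht.le, smoothStep_of_ge (by linarith), sub_self]
  have htends : Tendsto (fun k : ℕ => 1 / ((k : ℝ) + 1)) atTop (𝓝 0) :=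
    tendsto_one_div_add_atTop_nhds_zero_nat
  have hsupp : ∀ᶠ k in atTop, tsupport (φ k) ⊆ Ioo c d := by
    filter_upwards [htends.eventually (gt_mem_nhds (show (0 : ℝ) < d - y by linarith [hy.2]))]
      with k hk
    refine (closure_minimal (fun t ht => ?_) isClosed_Icc).trans
      (Icc_subset_Ioo hx.1 (show y + 1 / ((k : ℝ) + 1) < d by linarith))
    by_contra hcon
    exact ht (hφ0 k t hcon)
  have hleft : Tendsto (fun k => ∫ t in Ioo c d, iteratedDeriv 1 (φ k) t • u t) atTop
      (𝓝 (u x - u y)) := by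
    have h1 := (tendsto_integral_deriv_smoothStep_smul hwM hwm (hcont x hx)).sub
      (tendsto_integral_deriv_smoothStep_smul hwM hwm (hcont y hy))
    have h2 : w x - w y = u x - u y := by
      rw [hw, indicator_of_mem hx, indicator_of_mem hy]
    rw [h2] at h1
    refine h1.congr fun k => ?_
    rw [← integral_sub (integrable_deriv_smoothStep_smul hwM hwm.aestronglyMeasurable k x)
      (integrable_deriv_smoothStep_smul hwM hwm.aestronglyMeasurable k y),
      ← integral_indicator measurableSet_Ioo]
    refine integral_congr_ae (ae_of_all _ fun t => ?_)
    simp only [iteratedDeriv_one, hφd, ← sub_smul, hw]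
    exact (indicator_smul_apply (Ioo c d)
      (fun t => deriv (smoothStep k x) t - deriv (smoothStep k y) t) u t).symm
  have hright : Tendsto (fun k => (-1 : ℝ) ^ 1 • ∫ t in Ioo c d, φ k t • g t) atTop
      (𝓝 ((-1 : ℝ) ^ 1 • ∫ t in Ioo c d, (Ioc x y).indicator g t)) := by
    refine Tendsto.const_smul ?_ _
    refine tendsto_integral_of_dominated_convergence (fun t => ‖g t‖) (fun k => ?_) hg.norm
      (fun k => ae_of_all _ fun t => ?_) (ae_of_all _ fun t => ?_)
    · exact (((contDiff_smoothStep k x).continuous.sub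
        (contDiff_smoothStep k y).continuous).aestronglyMeasurable).smul hg.1
    · rw [norm_smul]
      refine mul_le_of_le_one_left (norm_nonneg _) ?_
      rw [Real.norm_eq_abs, abs_le]
      simp only [hφ, Pi.sub_apply, smoothStep]
      constructor <;> linarith [Real.smoothTransition.nonneg (((k : ℝ) + 1) * (t - x)),
        Real.smoothTransition.nonneg (((k : ℝ) + 1) * (t - y)),
        Real.smoothTransition.le_one (((k : ℝ) + 1) * (t - x)),
        Real.smoothTransition.le_one (((k : ℝ) + 1) * (t - y))]
    · -- pointwise, the steps at a point converge to the indicator of the half-line to its right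
      have hstep : ∀ z, z < t → ∀ᶠ k : ℕ in atTop, smoothStep k z t = 1 := fun z hz => by
        filter_upwards [htends.eventually (gt_mem_nhds (show (0 : ℝ) < t - z by linarith))]
          with k hk
        exact smoothStep_of_ge (by linarith)
      rcases le_or_gt t x with htx | htx
      · rw [indicator_of_notMem fun hmem => not_lt.2 htx hmem.1]
        refine tendsto_const_nhds.congr fun k => ?_
        simp [hφ, smoothStep_of_le htx, smoothStep_of_le (htx.trans hxy)]
      rcases le_or_gt t y with hty | hty
      · rw [indicator_of_mem (show t ∈ Ioc x y from ⟨htx, hty⟩)]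
        refine tendsto_const_nhds.congr' ?_
        filter_upwards [hstep x htx] with k hk
        simp [hφ, hk, smoothStep_of_le hty]
      · rw [indicator_of_notMem fun hmem => not_lt.2 hmem.2 hty]
        refine tendsto_const_nhds.congr' ?_
        filter_upwards [hstep x htx, hstep y hty] with k hk hk'
        simp [hφ, hk, hk']
  have heq : ∀ᶠ k in atTop, (-1 : ℝ) ^ 1 • ∫ t in Ioo c d, φ k t • g t =
      ∫ t in Ioo c d, iteratedDeriv 1 (φ k) t • u t := by
    filter_upwards [hsupp] with k hk
    refine (h (φ k) ((contDiff_smoothStep k x).sub (contDiff_smoothStep k y)) ?_ hk).symm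
    exact HasCompactSupport.intro isCompact_Icc (hφ0 k)
  have hlim := tendsto_nhds_unique hleft (hright.congr' heq)
  rw [setIntegral_indicator measurableSet_Ioc, inter_eq_right.2 (show Ioc x y ⊆ Ioo c d from
    fun t ht => ⟨hx.1.trans ht.1, ht.2.trans_lt hy.2⟩),
    ← intervalIntegral.integral_of_le hxy] at hlim
  rw [← neg_sub, hlim]
  simp

lemma IsWeakDeriv.sub_eq_integral {n : ℕ} {c d : ℝ} (hcd : c < d) {u g : ℝ → State n}
    (hu : ContinuousOn u (Icc c d)) (hg : IntegrableOn g (Ioo c d)) (h : IsWeakDeriv c d 1 u g)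
    {x : ℝ} (hx : x ∈ Icc c d) :
    u x - u c = ∫ t in c..x, g t := by
  have hgI : IntegrableOn g (uIcc c d) := by
    rw [uIcc_of_le hcd.le, integrableOn_Icc_iff_integrableOn_Ioo]; exact hg
  have hprim : ContinuousOn (fun x => ∫ t in c..x, g t) (Icc c d) := by
    have := intervalIntegral.continuousOn_primitive_interval hgI
    rwa [uIcc_of_le hcd.le] at this
  have hii : ∀ y ∈ Icc c d, IntervalIntegrable g volume c y := fun y hy =>
    (hgI.mono_set (by rw [uIcc_of_le hy.1, uIcc_of_le hcd.le]
                      exact Icc_subset_Icc_right hy.2)).intervalIntegrable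
  set m := (c + d) / 2 with hm
  have hmem : m ∈ Ioo c d := ⟨by linarith, by linarith⟩
  have hconst : EqOn (fun y => u y - ∫ t in c..y, g t)
      (fun _ => u m - ∫ t in c..m, g t) (Ioo c d) := by
    have key : ∀ y ∈ Ioo c d, ∀ z ∈ Ioo c d, y ≤ z →
        u z - (∫ t in c..z, g t) = u y - ∫ t in c..y, g t := by
      intro y hy z hz hyz
      have h1 := h.sub_eq_integral_of_mem_Ioo hu hg hy hz hyz
      have h2 := intervalIntegral.integral_add_adjacent_intervals
        (hii y (Ioo_subset_Icc_self hy))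
        ((hii y (Ioo_subset_Icc_self hy)).symm.trans (hii z (Ioo_subset_Icc_self hz)))
      rw [← h1] at h2
      rw [← h2]
      abel
    intro y hy
    rcases le_total y m with hym | hym
    · exact (key y hy m hmem hym).symm
    · exact key m hmem y hy hym
  have hall := hconst.of_subset_closure (hu.sub hprim) continuousOn_const Ioo_subset_Icc_self
    (by rw [closure_Ioo hcd.ne])
  have h1 := hall hx
  have h2 := hall (left_mem_Icc.2 hcd.le)
  simp only [intervalIntegral.integral_same, sub_zero] at h1 h2
  rw [h2, ← h1]
  abel

/-! ### Polynomial approximation of functions with a square-integrable weak derivative -/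

lemma exists_derivative_eq {q : ℝ[X]} {N : ℕ} (hq : q.natDegree ≤ N) :
    ∃ Q : ℝ[X], derivative Q = q ∧ Q.natDegree ≤ N + 1 := by
  refine ⟨∑ k ∈ Finset.range (N + 1), C (q.coeff k / (k + 1)) * X ^ (k + 1), ?_, ?_⟩
  · rw [derivative_sum]
    conv_rhs => rw [q.as_sum_range_C_mul_X_pow' (show q.natDegree < N + 1 by omega)]
    refine Finset.sum_congr rfl fun k _ => ?_
    rw [derivative_C_mul_X_pow]
    have : ((k : ℝ) + 1) ≠ 0 := by positivity
    simp [div_mul_cancel₀ _ this]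
  · refine natDegree_sum_le_of_forall_le _ _ fun k hk => ?_
    have := Finset.mem_range.1 hk
    exact (natDegree_C_mul_X_pow_le _ _).trans (by omega)

/-- The `L²` projection of an integrable function onto the polynomials of degree at most `N`. -/
lemma exists_integral_sub_mul_eq_zero {g : ℝ → ℝ}
    (hg : IntervalIntegrable g volume (-Real.sqrt 3) (Real.sqrt 3)) (N : ℕ) :
    ∃ q : ℝ[X], q.natDegree ≤ N ∧ ∀ r : ℝ[X], r.natDegree ≤ N →
      ∫ z in (-Real.sqrt 3)..(Real.sqrt 3), (g z - q.eval z) * r.eval z = 0 := by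
  set S := Real.sqrt 3 with hS
  set b : ℕ → ℝ := fun k => (∫ z in (-S)..S, g z * (Phi k).eval z) / polyInt (Phi k * Phi k)
    with hb
  have hgr : ∀ r : ℝ[X], IntervalIntegrable (fun z => g z * r.eval z) volume (-S) S := fun r =>
    hg.mul_continuousOn r.continuous.continuousOn
  refine ⟨∑ k ∈ Finset.range (N + 1), b k • Phi k, ?_, fun r hr => ?_⟩
  · refine natDegree_sum_le_of_forall_le _ _ fun k hk => ?_
    refine (natDegree_smul_le _ _).trans ?_
    rw [natDegree_Phi]; have := Finset.mem_range.1 hk; omega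
  set q := ∑ k ∈ Finset.range (N + 1), b k • Phi k with hq
  obtain ⟨a, ha⟩ := exists_eq_sum_Phi hr
  have h1 : ∫ z in (-S)..S, (g z - q.eval z) * r.eval z =
      (∫ z in (-S)..S, g z * r.eval z) - polyInt (q * r) := by
    rw [polyInt_apply, ← intervalIntegral.integral_sub (hgr r)
      ((q * r).continuous.intervalIntegrable _ _)]
    refine intervalIntegral.integral_congr fun z _ => ?_
    simp only [eval_mul]; ring
  have h2 : ∫ z in (-S)..S, g z * r.eval z =
      ∑ k ∈ Finset.range (N + 1), a k * ∫ z in (-S)..S, g z * (Phi k).eval z := by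
    rw [ha]
    simp only [eval_finsetSum, eval_smul, smul_eq_mul, Finset.mul_sum]
    rw [intervalIntegral.integral_finsetSum]
    · refine Finset.sum_congr rfl fun k _ => ?_
      rw [← intervalIntegral.integral_const_mul]
      refine intervalIntegral.integral_congr fun z _ => ?_
      ring
    · intro k _
      refine ((hgr (Phi k)).const_mul (a k)).congr fun z _ => ?_
      ring
  rw [h1, h2, ha, hq, polyInt_sum_mul_sum, sub_eq_zero]
  refine Finset.sum_congr rfl fun k _ => ?_
  have h3 : polyInt (Phi k * Phi k) ≠ 0 := by
    rw [polyInt_Phi_sq_eq]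
    have := sqrt_three_pos
    positivity
  rw [hb]
  field_simp

lemma memLp_eval (q : ℝ[X]) (c d : ℝ) :
    MemLp (fun z => q.eval z) 2 (volume.restrict (Ioc c d)) := by
  obtain ⟨C, hC⟩ := isCompact_Icc.exists_bound_of_continuousOn
    (q.continuous.continuousOn (s := Icc c d))
  refine MemLp.of_bound q.continuous.aestronglyMeasurable C ?_
  filter_upwards [ae_restrict_mem measurableSet_Ioc] with z hz
  exact hC z (Ioc_subset_Icc_self hz)

lemma exists_polynomial_integral_sub_sq_le {g : ℝ → ℝ}
    (hg : MemLp g 2 (volume.restrict (Ioo (-Real.sqrt 3) (Real.sqrt 3)))) {ε : ℝ} (hε : 0 < ε) :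
    ∃ q : ℝ[X], ∫ z in (-Real.sqrt 3)..(Real.sqrt 3), (g z - q.eval z) ^ 2 ≤ ε := by
  have hS := sqrt_three_pos
  set S := Real.sqrt 3 with hSdef
  rw [restrict_Ioo_eq_restrict_Ioc] at hg
  have h2 : ENNReal.ofReal 2 = 2 := by simp
  obtain ⟨h, hh, hhm⟩ := MemLp.exists_boundedContinuous_integral_rpow_sub_le (p := 2) (by norm_num)
    (by rw [h2]; exact hg) (show 0 < ε / 4 by positivity)
  rw [h2] at hhm
  obtain ⟨q, hq⟩ := exists_polynomial_near_of_continuousOn (-S) S h h.continuous.continuousOn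
    (Real.sqrt (ε / (8 * S))) (by positivity)
  refine ⟨q, ?_⟩
  rw [← intervalIntegral.integral_of_le (by linarith)] at hh
  have hint2 : IntervalIntegrable (fun z => ‖g z - h z‖ ^ (2 : ℝ)) volume (-S) S := by
    rw [intervalIntegrable_iff_integrableOn_Ioc_of_le (by linarith)]
    have := (hg.sub hhm).integrable_sq
    refine this.congr (ae_of_all _ fun z => ?_)
    simp
  have hle : ∫ z in (-S)..S, (g z - q.eval z) ^ 2 ≤
      ∫ z in (-S)..S, (2 * ‖g z - h z‖ ^ (2 : ℝ) + 2 * (ε / (8 * S))) := by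
    have hint1 : IntervalIntegrable (fun z => (g z - q.eval z) ^ 2) volume (-S) S := by
      rw [intervalIntegrable_iff_integrableOn_Ioc_of_le (by linarith)]
      exact (hg.sub (memLp_eval q _ _)).integrable_sq
    refine intervalIntegral.integral_mono_on (by linarith) hint1
      ((hint2.const_mul 2).add intervalIntegrable_const) fun z hz => ?_
    have h3 := (hq z hz).le
    have h4 : (q.eval z - h z) ^ 2 ≤ ε / (8 * S) := by
      rw [← sq_abs]
      exact (Real.le_sqrt (abs_nonneg _) (by positivity)).1 h3
    have h5 : ‖g z - h z‖ ^ (2 : ℝ) = (g z - h z) ^ 2 := by simp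
    rw [h5]
    nlinarith [sq_nonneg ((g z - h z) + (q.eval z - h z))]
  refine hle.trans ?_
  rw [intervalIntegral.integral_add (hint2.const_mul 2) intervalIntegrable_const,
    intervalIntegral.integral_const_mul, intervalIntegral.integral_const]
  have h6 : (S - -S) • (2 * (ε / (8 * S))) = ε / 2 := by
    rw [smul_eq_mul]; field_simp; ring
  rw [h6]
  linarith

/-- Integration by parts against a polynomial, for a primitive vanishing at both endpoints. -/
lemma integral_primitive_mul_derivative {f : ℝ → ℝ} {c d : ℝ}
    (hf : IntervalIntegrable f volume c d) (h0 : ∫ z in c..d, f z = 0) (R : ℝ[X]) :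
    ∫ x in c..d, (∫ z in c..x, f z) * (derivative R).eval x = -∫ x in c..d, f x * R.eval x := by
  have hac := hf.absolutelyContinuousOnInterval_intervalIntegral (c := c) left_mem_uIcc
  have hR : AbsolutelyContinuousOnInterval (fun x => R.eval x) c d := by
    obtain ⟨K, hK⟩ := (show ContDiff ℝ 1 (fun x => R.eval x) by simpa using R.contDiff_aeval (𝕜 := ℝ) (n := 1)).contDiffOn.exists_lipschitzOnWith (s := uIcc c d)
      (by norm_num) (convex_uIcc _ _) isCompact_uIcc
    exact hK.absolutelyContinuousOnInterval
  have h := hac.integral_mul_deriv_eq_deriv_mul hR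
  simp only [h0, intervalIntegral.integral_same, zero_mul, sub_zero, zero_sub,
    Polynomial.deriv] at h
  rw [h]
  congr 1
  refine intervalIntegral.integral_congr_ae ?_
  filter_upwards [hf.ae_hasDerivAt_integral] with x hx hmem
  rw [(hx (uIoc_subset_uIcc hmem) c left_mem_uIcc).deriv]

/-- A duality estimate: a primitive of a function orthogonal to all polynomials of degree at most
`N` gains a factor `(N + 1)⁻¹` in `L²`. Testing the primitive against a polynomial `r` and
integrating by parts, the primitive of `r` may be replaced by its distance to the polynomials of
degree at most `N`, which the Jackson inequality controls. -/
lemma integral_primitive_sq_le {f : ℝ → ℝ} {N : ℕ}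
    (hf : IntervalIntegrable f volume (-Real.sqrt 3) (Real.sqrt 3))
    (hf2 : IntervalIntegrable (fun z => f z ^ 2) volume (-Real.sqrt 3) (Real.sqrt 3))
    (horth : ∀ r : ℝ[X], r.natDegree ≤ N →
      ∫ z in (-Real.sqrt 3)..(Real.sqrt 3), f z * r.eval z = 0) :
    ((N : ℝ) + 1) ^ 2 * ∫ x in (-Real.sqrt 3)..(Real.sqrt 3), (∫ z in (-Real.sqrt 3)..x, f z) ^ 2
      ≤ 3 * ∫ z in (-Real.sqrt 3)..(Real.sqrt 3), f z ^ 2 := by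
  have hS := sqrt_three_pos
  set S := Real.sqrt 3 with hSdef
  set e : ℝ → ℝ := fun x => ∫ z in (-S)..x, f z with he
  have hec : ContinuousOn e (Icc (-S) S) := by
    have := intervalIntegral.continuousOn_primitive_interval' hf (left_mem_uIcc)
    rwa [uIcc_of_le (by linarith)] at this
  have hei : ∀ F : ℝ → ℝ, ContinuousOn F (Icc (-S) S) → IntervalIntegrable F volume (-S) S :=
    fun F hF => by
      apply ContinuousOn.intervalIntegrable
      rwa [uIcc_of_le (by linarith)]
  have h0 : ∫ z in (-S)..S, f z = 0 := by simpa using horth 1 (by simp)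
  have hNpos : (0 : ℝ) < ((N : ℝ) + 1) ^ 2 := by positivity
  set K := ∫ z in (-S)..S, f z ^ 2 with hK
  -- the Cauchy-Schwarz estimate `|∫ e r| ≤ √(3 K) / (N + 1) * ‖r‖`, linearized
  have hdual : ∀ r : ℝ[X], 2 * ∫ x in (-S)..S, e x * r.eval x ≤
      3 / ((N : ℝ) + 1) ^ 2 * K + polyInt (r * r) := by
    intro r
    obtain ⟨R, hR, -⟩ := exists_derivative_eq (le_refl r.natDegree)
    obtain ⟨q, hq, hqle⟩ := exists_polyInt_sub_sq_le R N
    have h1 : ∫ x in (-S)..S, e x * r.eval x = -∫ x in (-S)..S, f x * (R - q).eval x := by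
      rw [← hR, integral_primitive_mul_derivative hf h0]
      have h2 : ∫ x in (-S)..S, f x * (R - q).eval x = ∫ x in (-S)..S, f x * R.eval x := by
        simp only [eval_sub, mul_sub]
        rw [intervalIntegral.integral_sub
          (hf.mul_continuousOn R.continuous.continuousOn)
          (hf.mul_continuousOn q.continuous.continuousOn), horth q hq, sub_zero]
      rw [h2]
    rw [h1, hR] at *
    set t : ℝ := 3 / ((N : ℝ) + 1) ^ 2 with ht
    have htpos : 0 < t := by positivity
    have h3 : t⁻¹ * polyInt ((R - q) * (R - q)) ≤ polyInt (r * r) := by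
      rw [ht, inv_div, div_mul_eq_mul_div, div_le_iff₀ (by norm_num)]
      linarith
    have h4 : ∫ x in (-S)..S, -(2 * (f x * (R - q).eval x)) ≤
        ∫ x in (-S)..S, (t * f x ^ 2 + t⁻¹ * ((R - q) * (R - q)).eval x) := by
      refine intervalIntegral.integral_mono_on (by linarith)
        ((hf.mul_continuousOn (R - q).continuous.continuousOn).const_mul 2).neg
        ((hf2.const_mul t).add
          ((((R - q) * (R - q)).continuous.intervalIntegrable _ _).const_mul _)) fun x _ => ?_
      rw [eval_mul]
      set y := (R - q).eval x
      have h5 : t * f x ^ 2 + t⁻¹ * (y * y) + 2 * (f x * y) = t * (f x + t⁻¹ * y) ^ 2 := by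
        field_simp; ring
      have h6 : 0 ≤ t * (f x + t⁻¹ * y) ^ 2 := by positivity
      linarith
    rw [intervalIntegral.integral_add (hf2.const_mul t)
      ((((R - q) * (R - q)).continuous.intervalIntegrable _ _).const_mul _),
      intervalIntegral.integral_const_mul, intervalIntegral.integral_const_mul,
      intervalIntegral.integral_neg, intervalIntegral.integral_const_mul, ← hK] at h4
    have h7 : ∫ x in (-S)..S, ((R - q) * (R - q)).eval x = polyInt ((R - q) * (R - q)) := rfl
    rw [h7] at h4
    linarith
  have hmain : ∫ x in (-S)..S, e x ^ 2 ≤ 3 / ((N : ℝ) + 1) ^ 2 * K := by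
    refine le_of_forall_pos_le_add fun ε hε => ?_
    obtain ⟨r, hr⟩ := exists_polynomial_near_of_continuousOn (-S) S e hec
      (Real.sqrt (ε / (2 * S))) (by positivity)
    -- `e² = 2 e r - r² + (e - r)²`, with `r` uniformly close to `e`
    have h1 : ∫ x in (-S)..S, e x ^ 2 ≤
        ∫ x in (-S)..S, (2 * (e x * r.eval x) - (r * r).eval x + ε / (2 * S)) := by
      refine intervalIntegral.integral_mono_on (by linarith) (hei _ (hec.pow 2))
        (hei _ (by fun_prop)) fun x hx => ?_
      have h4 : (r.eval x - e x) ^ 2 ≤ ε / (2 * S) := by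
        rw [← sq_abs]
        exact (Real.le_sqrt (abs_nonneg _) (by positivity)).1 (hr x hx).le
      rw [eval_mul]
      nlinarith
    rw [intervalIntegral.integral_add (hei _ (by fun_prop)) intervalIntegrable_const,
      intervalIntegral.integral_sub (hei _ (by fun_prop)) (hei _ (by fun_prop)),
      intervalIntegral.integral_const_mul, intervalIntegral.integral_const] at h1
    have h2 : (S - -S) • (ε / (2 * S)) = ε := by rw [smul_eq_mul]; field_simp; ring
    have h7 : ∫ x in (-S)..S, (r * r).eval x = polyInt (r * r) := rfl
    rw [h2, h7] at h1
    linarith [hdual r]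
  calc _ ≤ ((N : ℝ) + 1) ^ 2 * (3 / ((N : ℝ) + 1) ^ 2 * K) := by gcongr
    _ = 3 * K := by field_simp

lemma abs_primitive_le {f : ℝ → ℝ}
    (hf : IntervalIntegrable f volume (-Real.sqrt 3) (Real.sqrt 3))
    (hf2 : IntervalIntegrable (fun z => f z ^ 2) volume (-Real.sqrt 3) (Real.sqrt 3))
    {x : ℝ} (hx : x ∈ Ixi) {t : ℝ} (ht : 0 < t) :
    |∫ z in (-Real.sqrt 3)..x, f z| ≤
      t⁻¹ * (∫ z in (-Real.sqrt 3)..(Real.sqrt 3), f z ^ 2) + t * Real.sqrt 3 := by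
  have hS := sqrt_three_pos
  set S := Real.sqrt 3 with hSdef
  calc |∫ z in (-S)..x, f z| ≤ ∫ z in (-S)..x, |f z| :=
        intervalIntegral.abs_integral_le_integral_abs hx.1
    _ ≤ ∫ z in (-S)..S, |f z| := by
        refine intervalIntegral.integral_mono_interval le_rfl hx.1 hx.2
          (ae_of_all _ fun z => abs_nonneg _) hf.abs
    _ ≤ ∫ z in (-S)..S, (t⁻¹ * f z ^ 2 + t * (1 / 2)) := by
        refine intervalIntegral.integral_mono_on (by linarith) hf.abs
          ((hf2.const_mul _).add intervalIntegrable_const) fun z _ => ?_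
        have h5 : t⁻¹ * f z ^ 2 + t * (1 / 2) - |f z| =
            t⁻¹ * ((|f z| - t / 2) ^ 2 + (t / 2) ^ 2) := by
          rw [← sq_abs (f z)]; field_simp; ring
        have h6 : 0 ≤ t⁻¹ * ((|f z| - t / 2) ^ 2 + (t / 2) ^ 2) := by positivity
        linarith
    _ = _ := by
        rw [intervalIntegral.integral_add (hf2.const_mul _) intervalIntegrable_const,
          intervalIntegral.integral_const_mul, intervalIntegral.integral_const, smul_eq_mul]
        ring

/-- A primitive of a square-integrable function is approximated by polynomials of degree at most
`N + 1`, uniformly and with an `L²` error of order `o(1 / N)`. -/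
lemma exists_polynomial_approx {u g : ℝ → ℝ}
    (hg : MemLp g 2 (volume.restrict (Ioo (-Real.sqrt 3) (Real.sqrt 3))))
    (hu : ∀ x ∈ Ixi, u x - u (-Real.sqrt 3) = ∫ z in (-Real.sqrt 3)..x, g z)
    {ε : ℝ} (hε : 0 < ε) :
    ∃ N₀ : ℕ, ∀ N ≥ N₀, ∃ p : ℝ[X], p.natDegree ≤ N + 1 ∧ (∀ x ∈ Ixi, |u x - p.eval x| ≤ ε) ∧
      ((N : ℝ) + 1) ^ 2 * ∫ x in (-Real.sqrt 3)..(Real.sqrt 3), (u x - p.eval x) ^ 2 ≤ ε := by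
  have hS := sqrt_three_pos
  set S := Real.sqrt 3 with hSdef
  set t : ℝ := ε / (2 * S) with ht
  have htpos : 0 < t := by positivity
  set η : ℝ := min (t * (ε / 2)) (ε / 3) with hη
  have hηpos : 0 < η := by positivity
  obtain ⟨q₀, hq₀⟩ := exists_polynomial_integral_sub_sq_le hg hηpos
  refine ⟨q₀.natDegree, fun N hN => ?_⟩
  rw [restrict_Ioo_eq_restrict_Ioc] at hg
  have hgi : IntervalIntegrable g volume (-S) S := by
    rw [intervalIntegrable_iff_integrableOn_Ioc_of_le (by linarith)]
    exact hg.integrable (by norm_num)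
  obtain ⟨q, hqN, horth⟩ := exists_integral_sub_mul_eq_zero hgi N
  rw [← hSdef] at horth
  have hi : ∀ q : ℝ[X], IntervalIntegrable (fun z => g z - q.eval z) volume (-S) S := fun q =>
    hgi.sub (q.continuous.intervalIntegrable _ _)
  have hi2 : ∀ q : ℝ[X], IntervalIntegrable (fun z => (g z - q.eval z) ^ 2) volume (-S) S := by
    intro q
    rw [intervalIntegrable_iff_integrableOn_Ioc_of_le (by linarith)]
    exact (hg.sub (memLp_eval q _ _)).integrable_sq
  have hK : ∫ z in (-S)..S, (g z - q.eval z) ^ 2 ≤ η := by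
    refine le_trans ?_ hq₀
    have h1 := horth (q - q₀) ((natDegree_sub_le _ _).trans (max_le hqN hN))
    have h2 : IntervalIntegrable (fun z => (g z - q.eval z) * (q - q₀).eval z) volume (-S) S :=
      (hi q).mul_continuousOn (q - q₀).continuous.continuousOn
    have h3 : ∫ z in (-S)..S, ((g z - q.eval z) ^ 2 + 2 * ((g z - q.eval z) * (q - q₀).eval z)) ≤
        ∫ z in (-S)..S, (g z - q₀.eval z) ^ 2 := by
      refine intervalIntegral.integral_mono_on (by linarith) ((hi2 q).add (h2.const_mul 2))
        (hi2 q₀) fun z _ => ?_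
      rw [eval_sub]
      nlinarith [sq_nonneg (q.eval z - q₀.eval z)]
    rw [intervalIntegral.integral_add (hi2 q) (h2.const_mul 2),
      intervalIntegral.integral_const_mul, h1] at h3
    linarith
  obtain ⟨Q, hQ, hQN⟩ := exists_derivative_eq hqN
  have herr : ∀ x ∈ Ixi, u x - (Q + C (u (-S) - Q.eval (-S))).eval x =
      ∫ z in (-S)..x, (g z - q.eval z) := by
    intro x hx
    rw [intervalIntegral.integral_sub (hgi.mono_set (by
        rw [uIcc_of_le hx.1, uIcc_of_le (by linarith)]; exact Icc_subset_Icc_right hx.2))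
      (q.continuous.intervalIntegrable _ _), ← hu x hx, ← hQ, integral_eval_derivative]
    simp only [eval_add, eval_C]
    ring
  refine ⟨Q + C (u (-S) - Q.eval (-S)), ?_, fun x hx => ?_, ?_⟩
  · exact (natDegree_add_le _ _).trans (max_le hQN (by simp))
  · rw [herr x hx]
    refine (abs_primitive_le (hi q) (hi2 q) hx htpos).trans ?_
    have h1 : t⁻¹ * ∫ z in (-S)..S, (g z - q.eval z) ^ 2 ≤ t⁻¹ * (t * (ε / 2)) := by
      gcongr; exact hK.trans (min_le_left _ _)
    rw [inv_mul_cancel_left₀ htpos.ne'] at h1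
    have h2 : t * S = ε / 2 := by rw [ht]; field_simp
    rw [← hSdef, h2]
    linarith
  · have h1 := integral_primitive_sq_le (hi q) (hi2 q) horth
    have h2 : ∫ x in (-S)..S, (u x - (Q + C (u (-S) - Q.eval (-S))).eval x) ^ 2 =
        ∫ x in (-S)..S, (∫ z in (-S)..x, (g z - q.eval z)) ^ 2 := by
      refine intervalIntegral.integral_congr fun x hx => ?_
      rw [uIcc_of_le (by linarith)] at hx
      simp only [herr x hx]
    rw [h2]
    have h3 : η ≤ ε / 3 := min_le_right _ _
    rw [← hSdef] at h1
    linarith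

/-! ### Integration against the law of `ξ` -/

lemma neg_sqrt_three_le : -Real.sqrt 3 ≤ Real.sqrt 3 := by linarith [sqrt_three_pos]

lemma volume_Ixi : volume Ixi = ENNReal.ofReal (2 * Real.sqrt 3) := by
  rw [Ixi, Real.volume_Icc]; congr 1; ring

lemma ae_mem_Ixi : ∀ᵐ z ∂nuXi, z ∈ Ixi :=
  ProbabilityTheory.ae_cond_mem measurableSet_Icc

lemma integrable_nuXi {E : Type*} [NormedAddCommGroup E] {F : ℝ → E}
    (hF : ContinuousOn F Ixi) : Integrable F nuXi := by
  have h1 : IntegrableOn F Ixi volume := hF.integrableOn_compact isCompact_Icc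
  rw [nuXi, ProbabilityTheory.cond]
  refine Integrable.smul_measure h1 ?_
  rw [volume_Ixi]
  have := sqrt_three_pos
  simp

lemma integral_nuXi (F : ℝ → ℝ) :
    ∫ z, F z ∂nuXi = (2 * Real.sqrt 3)⁻¹ * ∫ z in (-Real.sqrt 3)..(Real.sqrt 3), F z := by
  have hS := sqrt_three_pos
  rw [nuXi, ProbabilityTheory.cond, integral_smul_measure, volume_Ixi,
    intervalIntegral.integral_of_le neg_sqrt_three_le, Ixi, integral_Icc_eq_integral_Ioc,
    ENNReal.toReal_inv, ENNReal.toReal_ofReal (by positivity), smul_eq_mul]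

lemma integral_nuXi_mono {F G : ℝ → ℝ} (hF : ContinuousOn F Ixi) (hG : ContinuousOn G Ixi)
    (h : ∀ z ∈ Ixi, F z ≤ G z) : ∫ z, F z ∂nuXi ≤ ∫ z, G z ∂nuXi := by
  refine integral_mono_ae (integrable_nuXi hF) (integrable_nuXi hG) ?_
  filter_upwards [ae_mem_Ixi] with z hz using h z hz

lemma integral_nuXi_congr {F G : ℝ → ℝ} (h : ∀ z ∈ Ixi, F z = G z) :
    ∫ z, F z ∂nuXi = ∫ z, G z ∂nuXi := by
  refine integral_congr_ae ?_
  filter_upwards [ae_mem_Ixi] with z hz using h z hz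

/-! ### The Galerkin space -/

lemma mem_span_Phi_iff {N : ℕ} {g : ℝ → ℝ} :
    g ∈ Submodule.span ℝ {p : ℝ → ℝ | ∃ k ≤ N, p = fun z => (Phi k).eval z} ↔
      ∃ p : ℝ[X], p.natDegree ≤ N ∧ g = fun z => p.eval z := by
  constructor
  · intro h
    induction h using Submodule.span_induction with
    | mem x hx =>
      obtain ⟨k, hk, rfl⟩ := hx
      exact ⟨Phi k, by rwa [natDegree_Phi], rfl⟩
    | zero => exact ⟨0, by simp, by ext; simp⟩
    | add x y _ _ hx hy =>
      obtain ⟨p, hp, rfl⟩ := hx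
      obtain ⟨q, hq, rfl⟩ := hy
      exact ⟨p + q, (natDegree_add_le _ _).trans (max_le hp hq), by ext; simp⟩
    | smul c x _ hx =>
      obtain ⟨p, hp, rfl⟩ := hx
      exact ⟨c • p, (natDegree_smul_le _ _).trans hp, by ext; simp⟩
  · rintro ⟨p, hp, rfl⟩
    obtain ⟨a, rfl⟩ := exists_eq_sum_Phi hp
    have : (fun z => (∑ k ∈ Finset.range (N + 1), a k • Phi k).eval z) =
        ∑ k ∈ Finset.range (N + 1), a k • fun z => (Phi k).eval z := by
      ext z; simp [eval_finsetSum]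
    rw [this]
    refine Submodule.sum_mem _ fun k hk => Submodule.smul_mem _ _ (Submodule.subset_span ?_)
    exact ⟨k, by have := Finset.mem_range.1 hk; omega, rfl⟩

lemma mem_polySpace_iff {n N : ℕ} {u : ℝ → State n} :
    u ∈ polySpace n N ↔
      ∃ p : Fin n → ℝ[X], (∀ i, (p i).natDegree ≤ N) ∧ ∀ z i, u z i = (p i).eval z := by
  constructor
  · intro h
    choose p hp hpu using fun i => mem_span_Phi_iff.1 (h i)
    exact ⟨p, hp, fun z i => congrFun (hpu i) z⟩
  · rintro ⟨p, hp, hpu⟩ i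
    exact mem_span_Phi_iff.2 ⟨p i, hp i, by ext z; exact hpu z i⟩

lemma continuous_of_mem_polySpace {n N : ℕ} {u : ℝ → State n} (hu : u ∈ polySpace n N) :
    Continuous u := by
  obtain ⟨p, -, hp⟩ := mem_polySpace_iff.1 hu
  have hu' : u = fun z => WithLp.toLp 2 fun i => (p i).eval z := by
    ext z i; exact hp z i
  rw [hu']
  exact (PiLp.continuous_toLp 2 _).comp (continuous_pi fun i => (p i).continuous)

lemma comp_mem_polySpace {n N : ℕ} (T : State n →L[ℝ] State n) {u : ℝ → State n}
    (hu : u ∈ polySpace n N) : (fun z => T (u z)) ∈ polySpace n N := by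
  obtain ⟨p, hp, hpu⟩ := mem_polySpace_iff.1 hu
  refine mem_polySpace_iff.2
    ⟨fun i => ∑ j, (T (EuclideanSpace.single j 1) i) • p j, fun i => ?_, fun z i => ?_⟩
  · exact natDegree_sum_le_of_forall_le _ _ fun j _ => (natDegree_smul_le _ _).trans (hp j)
  · have h1 : u z = ∑ j, (u z j) • EuclideanSpace.single j (1 : ℝ) := by
      have := (EuclideanSpace.basisFun (Fin n) ℝ).sum_repr (u z)
      simpa using this.symm
    conv_lhs => rw [h1]
    simp [eval_finsetSum, hpu, mul_comm]

/-- The inverse inequality on the Galerkin space. -/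
lemma norm_sq_le_of_mem_polySpace {n N : ℕ} {u : ℝ → State n} (hu : u ∈ polySpace n N) {y : ℝ}
    (hy : y ∈ Ixi) : ‖u y‖ ^ 2 ≤ 2 * ((N : ℝ) + 1) ^ 2 * ∫ z, ‖u z‖ ^ 2 ∂nuXi := by
  obtain ⟨p, hp, hpu⟩ := mem_polySpace_iff.1 hu
  have hS := sqrt_three_pos
  have h1 : ∫ z, ‖u z‖ ^ 2 ∂nuXi = ∑ i, ∫ z, (p i).eval z ^ 2 ∂nuXi := by
    rw [← integral_finsetSum _ fun i _ =>
      integrable_nuXi (F := fun z => (p i).eval z ^ 2) (by fun_prop)]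
    refine integral_congr_ae (ae_of_all _ fun z => ?_)
    simp only [EuclideanSpace.real_norm_sq_eq, hpu]
  rw [h1, EuclideanSpace.real_norm_sq_eq, Finset.mul_sum]
  refine Finset.sum_le_sum fun i _ => ?_
  have h2 := eval_sq_le (hp i) hy
  rw [hpu, integral_nuXi]
  have h3 : ∫ z in (-Real.sqrt 3)..(Real.sqrt 3), (p i).eval z ^ 2 = polyInt (p i * p i) := by
    rw [polyInt_apply]; simp only [eval_mul, pow_two]
  rw [h3]
  have h4 : 2 * ((N : ℝ) + 1) ^ 2 * ((2 * Real.sqrt 3)⁻¹ * polyInt (p i * p i)) =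
      ((N : ℝ) + 1) ^ 2 * polyInt (p i * p i) / Real.sqrt 3 := by field_simp
  rw [h4, le_div_iff₀ hS]
  linarith

lemma eq_of_eqOn_Ixi {n N : ℕ} {u v : ℝ → State n} (hu : u ∈ polySpace n N)
    (hv : v ∈ polySpace n N) (h : EqOn u v Ixi) : u = v := by
  obtain ⟨p, -, hpu⟩ := mem_polySpace_iff.1 hu
  obtain ⟨q, -, hqv⟩ := mem_polySpace_iff.1 hv
  have hpq : ∀ i, p i = q i := fun i => by
    refine Polynomial.eq_of_infinite_eval_eq _ _
      ((Icc_infinite (show -Real.sqrt 3 < Real.sqrt 3 by linarith [sqrt_three_pos])).mono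
        fun z hz => ?_)
    change (p i).eval z = (q i).eval z
    rw [← hpu, ← hqv, h hz]
  ext z i
  rw [hpu, hqv, hpq]

/-- The `L²(ν_ξ)`-orthonormal coordinates `x ↦ ∑_{i,k} x_{i,k} √(2k+1) Φ_k e_i` on the Galerkin
space. -/
noncomputable def ofCoords (n N : ℕ) :
    EuclideanSpace ℝ (Fin n × Fin (N + 1)) →ₗ[ℝ] (ℝ → State n) where
  toFun x z := WithLp.toLp 2 fun i =>
    ∑ k : Fin (N + 1), x (i, k) * (Real.sqrt (2 * (k : ℕ) + 1) * (Phi k).eval z)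
  map_add' x y := by
    ext z i
    simp [add_mul, Finset.sum_add_distrib]
  map_smul' c x := by
    ext z i
    simp [Finset.mul_sum, mul_assoc]

lemma ofCoords_apply (n N : ℕ) (x : EuclideanSpace ℝ (Fin n × Fin (N + 1))) (z : ℝ) (i : Fin n) :
    ofCoords n N x z i =
      ∑ k : Fin (N + 1), x (i, k) * (Real.sqrt (2 * (k : ℕ) + 1) * (Phi k).eval z) := rfl

/-- The coefficient sequence, in the basis `Φ_k`, of the `i`-th component of `ofCoords n N x`. -/
noncomputable def legendreCoeff {n N : ℕ} (x : EuclideanSpace ℝ (Fin n × Fin (N + 1)))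
    (i : Fin n) (k : ℕ) : ℝ :=
  if h : k < N + 1 then x (i, ⟨k, h⟩) * Real.sqrt (2 * k + 1) else 0

lemma ofCoords_apply_eq_eval {n N : ℕ} (x : EuclideanSpace ℝ (Fin n × Fin (N + 1))) (z : ℝ)
    (i : Fin n) : ofCoords n N x z i =
      (∑ k ∈ Finset.range (N + 1), legendreCoeff x i k • Phi k).eval z := by
  rw [ofCoords_apply, eval_finsetSum, Finset.sum_range]
  refine Finset.sum_congr rfl fun k _ => ?_
  simp only [legendreCoeff, k.2, dite_true, eval_smul, smul_eq_mul]
  ring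

lemma ofCoords_mem {n N : ℕ} (x : EuclideanSpace ℝ (Fin n × Fin (N + 1))) :
    ofCoords n N x ∈ polySpace n N := by
  refine mem_polySpace_iff.2
    ⟨fun i => ∑ k ∈ Finset.range (N + 1), legendreCoeff x i k • Phi k, fun i => ?_,
      fun z i => ofCoords_apply_eq_eval x z i⟩
  refine natDegree_sum_le_of_forall_le _ _ fun k hk => ?_
  refine (natDegree_smul_le _ _).trans ?_
  rw [natDegree_Phi]; have := Finset.mem_range.1 hk; omega

lemma exists_ofCoords_eq {n N : ℕ} {u : ℝ → State n} (hu : u ∈ polySpace n N) :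
    ∃ x, ofCoords n N x = u := by
  obtain ⟨p, hp, hpu⟩ := mem_polySpace_iff.1 hu
  choose a ha using fun i => exists_eq_sum_Phi (hp i)
  refine ⟨WithLp.toLp 2 fun ik => a ik.1 ik.2 / Real.sqrt (2 * (ik.2 : ℕ) + 1), ?_⟩
  ext z i
  rw [ofCoords_apply, hpu, ha, eval_finsetSum, Finset.sum_range]
  refine Finset.sum_congr rfl fun k _ => ?_
  have : Real.sqrt (2 * (k : ℕ) + 1) ≠ 0 := by positivity
  rw [eval_smul, smul_eq_mul]
  field_simp

lemma integral_inner_ofCoords {n N : ℕ} (x y : EuclideanSpace ℝ (Fin n × Fin (N + 1))) :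
    ∫ z, inner ℝ (ofCoords n N x z) (ofCoords n N y z) ∂nuXi = inner ℝ x y := by
  have hS := sqrt_three_pos
  have h1 : ∀ i : Fin n, ∫ z, ofCoords n N x z i * ofCoords n N y z i ∂nuXi =
      ∑ k : Fin (N + 1), x (i, k) * y (i, k) := by
    intro i
    rw [integral_nuXi]
    simp only [ofCoords_apply_eq_eval, ← eval_mul]
    rw [← polyInt_apply, polyInt_sum_mul_sum, Finset.mul_sum, Finset.sum_range]
    refine Finset.sum_congr rfl fun k _ => ?_
    have h2 : (0 : ℝ) ≤ 2 * ((k : ℕ) : ℝ) + 1 := by positivity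
    have h3 : (2 * ((k : ℕ) : ℝ) + 1) ≠ 0 := by positivity
    simp only [legendreCoeff, k.2, dite_true, polyInt_Phi_sq_eq]
    calc _ = x (i, k) * y (i, k) * ((Real.sqrt (2 * (k : ℕ) + 1) * Real.sqrt (2 * (k : ℕ) + 1)) *
          ((2 * Real.sqrt 3)⁻¹ * (2 * Real.sqrt 3)) / (2 * (k : ℕ) + 1)) := by simp only; ring
      _ = _ := by
        rw [Real.mul_self_sqrt h2, inv_mul_cancel₀ (by positivity), mul_one, div_self h3, mul_one]
  have hc : ∀ (x : EuclideanSpace ℝ (Fin n × Fin (N + 1))) (i : Fin n),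
      Continuous fun z => ofCoords n N x z i := fun x i => by
    simp only [ofCoords_apply_eq_eval]; exact Polynomial.continuous _
  simp only [PiLp.inner_apply, RCLike.inner_apply, conj_trivial]
  rw [integral_finsetSum _ fun i _ => integrable_nuXi
    (F := fun z => ofCoords n N y z i * ofCoords n N x z i)
    ((hc y i).mul (hc x i)).continuousOn, Fintype.sum_prod_type]
  refine Finset.sum_congr rfl fun i _ => ?_
  rw [← Finset.sum_congr rfl (fun k _ => mul_comm (x (i, k)) (y (i, k))), ← h1 i]
  simp only [mul_comm]

lemma integral_norm_sq_ofCoords {n N : ℕ} (x : EuclideanSpace ℝ (Fin n × Fin (N + 1))) :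
    ∫ z, ‖ofCoords n N x z‖ ^ 2 ∂nuXi = ‖x‖ ^ 2 := by
  rw [← real_inner_self_eq_norm_sq, ← integral_inner_ofCoords]
  simp only [real_inner_self_eq_norm_sq]

/-! ### Strongly monotone fields -/

/-- A strongly monotone Lipschitz map on a Hilbert space has a zero: `x ↦ x - τ G x` is a
contraction for small `τ > 0`. -/
lemma exists_zero_of_strongly_monotone {V : Type*} [NormedAddCommGroup V] [InnerProductSpace ℝ V]
    [CompleteSpace V] (G : V → V) {c L : ℝ} (hc : 0 < c)
    (hmono : ∀ x y, c * ‖x - y‖ ^ 2 ≤ inner ℝ (G x - G y) (x - y))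
    (hlip : ∀ x y, ‖G x - G y‖ ≤ L * ‖x - y‖) : ∃ x, G x = 0 := by
  set M := max L c with hM
  have hM0 : 0 < M := hc.trans_le (le_max_right _ _)
  set τ := c / M ^ 2 with hτ
  have hτ0 : 0 < τ := by positivity
  have hcM : c ^ 2 / M ^ 2 ≤ 1 := by
    rw [div_le_one (by positivity)]
    exact pow_le_pow_left₀ hc.le (le_max_right _ _) 2
  set K : NNReal := ⟨Real.sqrt (1 - c ^ 2 / M ^ 2), Real.sqrt_nonneg _⟩ with hK
  have hK2 : (K : ℝ) ^ 2 = 1 - c ^ 2 / M ^ 2 := Real.sq_sqrt (by linarith)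
  have hK1 : K < 1 := by
    rw [← NNReal.coe_lt_coe, NNReal.coe_one]
    have : 0 < c ^ 2 / M ^ 2 := by positivity
    have h2 : (K : ℝ) ^ 2 < 1 := by linarith
    exact (sq_lt_one_iff₀ K.2).1 h2
  have hcon : ContractingWith K fun x => x - τ • G x := by
    refine ⟨hK1, LipschitzWith.of_dist_le_mul fun x y => ?_⟩
    rw [dist_eq_norm, dist_eq_norm]
    refine abs_le_of_sq_le_sq' ?_ (by positivity) |>.2
    have h1 : x - τ • G x - (y - τ • G y) = (x - y) - τ • (G x - G y) := by
      rw [smul_sub]; abel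
    have h2 : ‖G x - G y‖ ^ 2 ≤ M ^ 2 * ‖x - y‖ ^ 2 := by
      rw [← mul_pow]
      refine pow_le_pow_left₀ (norm_nonneg _) ((hlip x y).trans ?_) 2
      gcongr; exact le_max_left _ _
    rw [h1, norm_sub_sq_real, inner_smul_right, norm_smul, mul_pow, mul_pow, hK2,
      Real.norm_eq_abs, sq_abs, real_inner_comm]
    have h3 : 1 - c ^ 2 / M ^ 2 = 1 - 2 * τ * c + τ ^ 2 * M ^ 2 := by
      rw [hτ]; field_simp; ring
    rw [h3]
    have h4 := mul_le_mul_of_nonneg_left (hmono x y) hτ0.le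
    have h5 := mul_le_mul_of_nonneg_left h2 (sq_nonneg τ)
    linarith
  refine ⟨hcon.fixedPoint _, ?_⟩
  have h : hcon.fixedPoint _ - τ • G (hcon.fixedPoint _) = hcon.fixedPoint _ :=
    hcon.fixedPoint_isFixedPt
  rw [sub_eq_self] at h
  exact (smul_eq_zero.1 h).resolve_left hτ0.ne'

/-- `u` lies in the Galerkin space and the residual of the parametrized field `F` along `u` is
orthogonal to it; `F` is already expressed in the normalized parameter `z`. -/
def IsDiscreteZero {n : ℕ} (F : State n → ℝ → State n) (N : ℕ) (u : ℝ → State n) : Prop :=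
  u ∈ polySpace n N ∧ ∀ v ∈ polySpace n N, ∫ z, inner ℝ (F (u z) z) (v z) ∂nuXi = 0

/-- A parametrized field that is uniformly strongly monotone and Lipschitz, and continuous along
continuous curves. -/
structure IsMonotoneField {n : ℕ} (H : State n → ℝ → State n) (c L : ℝ) : Prop where
  pos : 0 < c
  continuousOn : ∀ u : ℝ → State n, ContinuousOn u Ixi → ContinuousOn (fun z => H (u z) z) Ixi
  monotone : ∀ z ∈ Ixi, ∀ v w : State n, c * ‖v - w‖ ^ 2 ≤ inner ℝ (H v z - H w z) (v - w)
  lipschitz : ∀ z ∈ Ixi, ∀ v w : State n, ‖H v z - H w z‖ ≤ L * ‖v - w‖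

namespace IsMonotoneField

variable {n N : ℕ} {H : State n → ℝ → State n} {c L : ℝ}

lemma exists_isDiscreteZero (hH : IsMonotoneField H c L) (N : ℕ) :
    ∃ u, IsDiscreteZero H N u := by
  set V := EuclideanSpace ℝ (Fin n × Fin (N + 1))
  set U := ofCoords n N with hU
  have hUc : ∀ x, ContinuousOn (U x) Ixi := fun x =>
    (continuous_of_mem_polySpace (ofCoords_mem x)).continuousOn
  have hint : ∀ x y, ContinuousOn (fun z => inner ℝ (H (U x z) z) (U y z)) Ixi := fun x y =>
    (hH.continuousOn _ (hUc x)).inner (hUc y)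
  let ℓ : V → V →ₗ[ℝ] ℝ := fun x =>
    { toFun := fun y => ∫ z, inner ℝ (H (U x z) z) (U y z) ∂nuXi
      map_add' := fun y y' => by
        rw [← integral_add (integrable_nuXi (hint x y)) (integrable_nuXi (hint x y'))]
        simp only [map_add, Pi.add_apply, inner_add_right]
      map_smul' := fun a y => by
        simp only [map_smul, Pi.smul_apply, inner_smul_right, RingHom.id_apply, smul_eq_mul]
        exact integral_const_mul _ _ }
  let G : V → V := fun x =>
    (InnerProductSpace.toDual ℝ V).symm (LinearMap.toContinuousLinearMap (ℓ x))
  have hG : ∀ x y, inner ℝ (G x) y = ∫ z, inner ℝ (H (U x z) z) (U y z) ∂nuXi := fun x y =>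
    InnerProductSpace.toDual_symm_apply
  have hGsub : ∀ x y w, inner ℝ (G x - G y) w =
      ∫ z, inner ℝ (H (U x z) z - H (U y z) z) (U w z) ∂nuXi := fun x y w => by
    rw [inner_sub_left, hG, hG, ← integral_sub (integrable_nuXi (hint x w))
      (integrable_nuXi (hint y w))]
    simp only [inner_sub_left]
  have hsubc : ∀ x y, ContinuousOn (fun z => H (U x z) z - H (U y z) z) Ixi := fun x y =>
    (hH.continuousOn _ (hUc x)).sub (hH.continuousOn _ (hUc y))
  have hUsub : ∀ x y z, U (x - y) z = U x z - U y z := fun x y z => by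
    rw [map_sub, Pi.sub_apply]
  obtain ⟨x, hx⟩ := exists_zero_of_strongly_monotone G (c := c) (L := |L|) hH.pos
    (fun x y => by
      rw [hGsub, ← integral_norm_sq_ofCoords, ← integral_const_mul]
      refine integral_nuXi_mono (((hUc _).norm.pow 2).const_smul c)
        ((hsubc x y).inner (hUc _)) fun z hz => ?_
      rw [← hU, hUsub]
      exact hH.monotone z hz _ _)
    (fun x y => by
      -- test with `w = G x - G y` and absorb half of `‖w‖²`
      set w := G x - G y with hw
      have h1 : ‖w‖ ^ 2 ≤ ∫ z, (L ^ 2 / 2 * ‖U (x - y) z‖ ^ 2 + 1 / 2 * ‖U w z‖ ^ 2) ∂nuXi := by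
        rw [← real_inner_self_eq_norm_sq]
        conv_lhs => rw [hw]
        rw [hGsub]
        refine integral_nuXi_mono ((hsubc x y).inner (hUc _))
          ((((hUc _).norm.pow 2).const_smul (L ^ 2 / 2)).add
            (((hUc _).norm.pow 2).const_smul (1 / 2 : ℝ))) fun z hz => ?_
        have h2 := hH.lipschitz z hz (U x z) (U y z)
        rw [← hUsub] at h2
        have h3 := (real_inner_le_norm (H (U x z) z - H (U y z) z) (U w z)).trans
          (mul_le_mul_of_nonneg_right h2 (norm_nonneg _))
        refine h3.trans ?_
        nlinarith [sq_nonneg (L * ‖U (x - y) z‖ - ‖U w z‖)]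
      have hi : ∀ (a : ℝ) (x : V), Integrable (fun z => a * ‖U x z‖ ^ 2) nuXi := fun a x =>
        integrable_nuXi (((hUc x).norm.pow 2).const_smul a)
      rw [integral_add (hi _ _) (hi _ _), integral_const_mul,
        integral_const_mul, integral_norm_sq_ofCoords, integral_norm_sq_ofCoords] at h1
      refine (abs_le_of_sq_le_sq' ?_ (by positivity)).2
      rw [mul_pow, sq_abs]
      linarith)
  refine ⟨U x, ofCoords_mem x, fun v hv => ?_⟩
  obtain ⟨y, rfl⟩ := exists_ofCoords_eq hv
  rw [← hU, ← hG, hx, inner_zero_left]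

/-- A discrete zero of a strongly monotone field is quasi-optimal. -/
lemma integral_norm_sub_sq_le (hH : IsMonotoneField H c L) {u p ubar : ℝ → State n}
    (hubar : ContinuousOn ubar Ixi) (hzero : ∀ z ∈ Ixi, H (ubar z) z = 0)
    (hu : IsDiscreteZero H N u) (hp : p ∈ polySpace n N) :
    ∫ z, ‖u z - p z‖ ^ 2 ∂nuXi ≤ L ^ 2 / c ^ 2 * ∫ z, ‖p z - ubar z‖ ^ 2 ∂nuXi := by
  have hc := hH.pos
  have hpc := (continuous_of_mem_polySpace hp).continuousOn (s := Ixi)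
  have huc := (continuous_of_mem_polySpace hu.1).continuousOn (s := Ixi)
  have hHu := hH.continuousOn u huc
  have h0 := hu.2 (u - p) (Submodule.sub_mem _ hu.1 hp)
  have h1 : ∫ z, c * ‖u z - p z‖ ^ 2 ∂nuXi ≤
      ∫ z, (inner ℝ (H (u z) z) ((u - p) z) + (L ^ 2 / (2 * c) * ‖p z - ubar z‖ ^ 2 +
        c / 2 * ‖u z - p z‖ ^ 2)) ∂nuXi := by
    refine integral_nuXi_mono (by fun_prop)
      ((hHu.inner (huc.sub hpc)).add (by fun_prop)) fun z hz => ?_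
    have h2 := hH.monotone z hz (u z) (p z)
    have h3 := hH.lipschitz z hz (p z) (ubar z)
    rw [hzero z hz, sub_zero] at h3
    have h4 := (neg_le_of_abs_le (abs_real_inner_le_norm (H (p z) z) (u z - p z)))
    have h5 : ‖H (p z) z‖ * ‖u z - p z‖ ≤ L * ‖p z - ubar z‖ * ‖u z - p z‖ := by gcongr
    rw [inner_sub_left] at h2
    rw [Pi.sub_apply]
    have h6 : L ^ 2 / (2 * c) * ‖p z - ubar z‖ ^ 2 + c / 2 * ‖u z - p z‖ ^ 2 -
        L * ‖p z - ubar z‖ * ‖u z - p z‖ =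
        (2 * c)⁻¹ * (L * ‖p z - ubar z‖ - c * ‖u z - p z‖) ^ 2 := by
      field_simp; ring
    have h7 : 0 ≤ (2 * c)⁻¹ * (L * ‖p z - ubar z‖ - c * ‖u z - p z‖) ^ 2 := by positivity
    linarith
  rw [integral_add (integrable_nuXi (hHu.inner (huc.sub hpc)))
      (integrable_nuXi (by fun_prop)), h0, zero_add,
    integral_add (integrable_nuXi (by fun_prop)) (integrable_nuXi (by fun_prop)),
    integral_const_mul, integral_const_mul, integral_const_mul] at h1
  have h8 : L ^ 2 / c ^ 2 * ∫ z, ‖p z - ubar z‖ ^ 2 ∂nuXi =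
      2 / c * (L ^ 2 / (2 * c) * ∫ z, ‖p z - ubar z‖ ^ 2 ∂nuXi) := by field_simp
  have h9 : ∫ z, ‖u z - p z‖ ^ 2 ∂nuXi = 2 / c * (c / 2 * ∫ z, ‖u z - p z‖ ^ 2 ∂nuXi) := by
    field_simp
  rw [h8, h9]
  exact mul_le_mul_of_nonneg_left (by linarith) (by positivity)

lemma eq_of_isDiscreteZero (hH : IsMonotoneField H c L) {u v : ℝ → State n}
    (hu : IsDiscreteZero H N u) (hv : IsDiscreteZero H N v) : u = v := by
  have huc := (continuous_of_mem_polySpace hu.1).continuousOn (s := Ixi)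
  have hvc := (continuous_of_mem_polySpace hv.1).continuousOn (s := Ixi)
  have hmem := Submodule.sub_mem _ hu.1 hv.1
  have h1 := hu.2 _ hmem
  have h2 := hv.2 _ hmem
  have h3 : ∫ z, c * ‖u z - v z‖ ^ 2 ∂nuXi ≤
      ∫ z, (inner ℝ (H (u z) z) ((u - v) z) - inner ℝ (H (v z) z) ((u - v) z)) ∂nuXi := by
    refine integral_nuXi_mono (by fun_prop)
      (((hH.continuousOn u huc).inner (huc.sub hvc)).sub
        ((hH.continuousOn v hvc).inner (huc.sub hvc))) fun z hz => ?_
    rw [← inner_sub_left]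
    exact hH.monotone z hz _ _
  rw [integral_sub (integrable_nuXi ((hH.continuousOn u huc).inner (huc.sub hvc)))
    (integrable_nuXi ((hH.continuousOn v hvc).inner (huc.sub hvc))), h1, h2, sub_zero,
    integral_const_mul] at h3
  have h4 : ∫ z, ‖(u - v) z‖ ^ 2 ∂nuXi ≤ 0 := nonpos_of_mul_nonpos_right h3 hH.pos
  refine eq_of_eqOn_Ixi hu.1 hv.1 fun z hz => ?_
  have h5 := norm_sq_le_of_mem_polySpace hmem hz
  have h6 : 2 * ((N : ℝ) + 1) ^ 2 * ∫ z, ‖(u - v) z‖ ^ 2 ∂nuXi ≤ 0 :=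
    mul_nonpos_of_nonneg_of_nonpos (by positivity) h4
  have h7 : ‖(u - v) z‖ ^ 2 = 0 := le_antisymm (h5.trans h6) (by positivity)
  exact sub_eq_zero.1 (norm_eq_zero.1 (pow_eq_zero_iff (by norm_num) |>.1 h7))

end IsMonotoneField

/-! ### Truncation of the field outside a tube around the root -/

section Retraction

variable {E : Type*} [NormedAddCommGroup E] [NormedSpace ℝ E]

/-- The radial retraction onto the closed ball of radius `r > 0`. -/
noncomputable def retract (r : ℝ) (e : E) : E := (r / max r ‖e‖) • e

lemma retract_of_norm_le {r : ℝ} (hr : 0 < r) {e : E} (he : ‖e‖ ≤ r) : retract r e = e := by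
  rw [retract, max_eq_left he, div_self hr.ne', one_smul]

lemma norm_retract_le {r : ℝ} (hr : 0 < r) (e : E) : ‖retract r e‖ ≤ r := by
  have h : 0 < max r ‖e‖ := hr.trans_le (le_max_left _ _)
  rw [retract, norm_smul, Real.norm_of_nonneg (by positivity), div_mul_eq_mul_div,
    div_le_iff₀ h]
  exact mul_le_mul_of_nonneg_left (le_max_right _ _) hr.le

lemma norm_retract_sub_le {r : ℝ} (hr : 0 < r) (e f : E) :
    ‖retract r e - retract r f‖ ≤ 2 * ‖e - f‖ := by
  set a := max r ‖e‖ with ha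
  set b := max r ‖f‖ with hb
  have ha0 : 0 < a := hr.trans_le (le_max_left _ _)
  have hb0 : 0 < b := hr.trans_le (le_max_left _ _)
  have h1 : retract r e - retract r f = (r / a) • (e - f) + ((r / a) * ((b - a) / b)) • f := by
    rw [retract, retract, ← ha, ← hb, smul_sub]
    have : (r / a) * ((b - a) / b) = r / a - r / b := by field_simp
    rw [this, sub_smul]
    abel
  have hra : r / a ≤ 1 := (div_le_one ha0).2 (le_max_left _ _)
  have hab : |b - a| ≤ ‖e - f‖ := by
    rw [abs_sub_comm]
    exact (abs_max_sub_max_le_max _ _ _ _).trans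
      (max_le (by simp) (abs_norm_sub_norm_le _ _))
  have hfb : ‖f‖ / b ≤ 1 := (div_le_one hb0).2 (le_max_right _ _)
  have hra0 : 0 ≤ r / a := by positivity
  rw [h1]
  calc _ ≤ ‖(r / a) • (e - f)‖ + ‖((r / a) * ((b - a) / b)) • f‖ := norm_add_le _ _
    _ = (r / a) * ‖e - f‖ + (r / a) * (|b - a| * (‖f‖ / b)) := by
        rw [norm_smul, norm_smul, norm_mul, Real.norm_of_nonneg hra0, norm_div,
          Real.norm_of_nonneg hb0.le, Real.norm_eq_abs]
        ring
    _ ≤ 1 * ‖e - f‖ + 1 * (‖e - f‖ * 1) := by gcongr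
    _ = _ := by ring

lemma continuous_retract {r : ℝ} (hr : 0 < r) : Continuous (retract r : E → E) :=
  (LipschitzWith.of_dist_le_mul (K := 2) fun e f => by
    rw [dist_eq_norm, dist_eq_norm]; exact norm_retract_sub_le hr e f).continuous

end Retraction

variable {n : ℕ}

/-- The field obtained from `F` by keeping the linearization of `F` at the root `ubar z` and
evaluating the remainder at the radial retraction onto the ball of radius `r` around the root. -/
noncomputable def truncField (F : State n → ℝ → State n) (ubar : ℝ → State n) (r : ℝ)
    (u : State n) (z : ℝ) : State n :=
  jac F (ubar z) z (u - ubar z) + (F (ubar z + retract r (u - ubar z)) z -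
    jac F (ubar z) z (retract r (u - ubar z)))

lemma truncField_of_norm_le {F : State n → ℝ → State n} {ubar : ℝ → State n} {r : ℝ}
    (hr : 0 < r) {u : State n} {z : ℝ} (h : ‖u - ubar z‖ ≤ r) :
    truncField F ubar r u z = F u z := by
  rw [truncField, retract_of_norm_le hr h, add_sub_cancel, add_sub_cancel]

/-- Near a root with uniformly positive definite Jacobian, a suitable truncation of the field is
strongly monotone and Lipschitz. -/
lemma exists_isMonotoneField_truncField {F : State n → ℝ → State n}
    (hF : ContinuousOn (fun p : State n × ℝ => F p.1 p.2) (univ ×ˢ Ixi))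
    (hdiff : ∀ z ∈ Ixi, Differentiable ℝ fun u => F u z)
    (hjac : ContinuousOn (fun p : State n × ℝ => jac F p.1 p.2) (univ ×ˢ Ixi))
    {ubar : ℝ → State n} (hubar : ContinuousOn ubar Ixi) {lam : ℝ} (hlam : 0 < lam)
    (hdef : ∀ z ∈ Ixi, ∀ w, lam * ‖w‖ ^ 2 ≤ inner ℝ (jac F (ubar z) z w) w) :
    ∃ r L : ℝ, 0 < r ∧ 0 < L ∧ IsMonotoneField (truncField F ubar r) (lam / 2) L := by
  set A : ℝ → State n →L[ℝ] State n := fun z => jac F (ubar z) z with hA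
  have hAc : ContinuousOn A Ixi :=
    hjac.comp (hubar.prodMk continuousOn_id) fun z hz => ⟨mem_univ _, hz⟩
  obtain ⟨M, hM⟩ := isCompact_Icc.exists_bound_of_continuousOn hAc
  have htube : ∃ r, 0 < r ∧ ∀ z ∈ Ixi, ∀ e, ‖e‖ ≤ r →
      ‖jac F (ubar z + e) z - A z‖ ≤ lam / 4 := by
    have hc : ContinuousOn (fun p : State n × ℝ => jac F (ubar p.2 + p.1) p.2)
        (Metric.closedBall 0 1 ×ˢ Ixi) := by
      refine hjac.comp (f := fun p : State n × ℝ => (ubar p.2 + p.1, p.2))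
        (ContinuousOn.prodMk (ContinuousOn.add ?_ continuousOn_fst) continuousOn_snd)
        fun p hp => ⟨mem_univ _, hp.2⟩
      exact hubar.comp continuousOn_snd fun p hp => hp.2
    have hu := ((isCompact_closedBall (0 : State n) 1).prod
      (isCompact_Icc : IsCompact Ixi)).uniformContinuousOn_of_continuous hc
    obtain ⟨δ, hδ, h⟩ := Metric.uniformContinuousOn_iff.1 hu (lam / 4) (by positivity)
    refine ⟨min 1 (δ / 2), by positivity, fun z hz e he => ?_⟩
    have h1 := h (e, z) ⟨by simpa using he.trans (min_le_left _ _), hz⟩ (0, z)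
      ⟨by simp, hz⟩ (by
        rw [Prod.dist_eq, dist_self, dist_zero_right, max_eq_left (norm_nonneg _)]
        exact (he.trans (min_le_right _ _)).trans_lt (by linarith))
    rw [dist_eq_norm] at h1
    simpa using h1.le
  obtain ⟨r, hr, htube⟩ := htube
  have hrem : ∀ z ∈ Ixi, ∀ d e : State n,
      ‖(F (ubar z + retract r d) z - A z (retract r d)) -
        (F (ubar z + retract r e) z - A z (retract r e))‖ ≤ lam / 2 * ‖d - e‖ := by
    intro z hz d e
    have h1 := (convex_closedBall (ubar z) r).norm_image_sub_le_of_norm_hasFDerivWithin_le'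
      (f := fun u => F u z) (f' := fun u => jac F u z) (φ := A z) (C := lam / 4)
      (fun u _ => ((hdiff z hz) u).hasFDerivAt.hasFDerivWithinAt)
      (fun u hu => by
        have := htube z hz (u - ubar z) (by rwa [← mem_closedBall_iff_norm])
        rwa [add_sub_cancel] at this)
      (x := ubar z + retract r e) (y := ubar z + retract r d)
      (by rw [mem_closedBall_iff_norm, add_sub_cancel_left]; exact norm_retract_le hr _)
      (by rw [mem_closedBall_iff_norm, add_sub_cancel_left]; exact norm_retract_le hr _)
    rw [add_sub_add_left_eq_sub, map_sub] at h1
    rw [sub_sub_sub_comm]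
    refine h1.trans ?_
    have := norm_retract_sub_le hr d e
    calc _ ≤ lam / 4 * (2 * ‖d - e‖) := by gcongr
      _ = _ := by ring
  have hsub : ∀ z (v w : State n), truncField F ubar r v z - truncField F ubar r w z =
      A z (v - w) + ((F (ubar z + retract r (v - ubar z)) z - A z (retract r (v - ubar z))) -
        (F (ubar z + retract r (w - ubar z)) z - A z (retract r (w - ubar z)))) := by
    intro z v w
    have : A z (v - w) = A z (v - ubar z) - A z (w - ubar z) := by
      rw [← map_sub, sub_sub_sub_cancel_right]
    rw [this]
    simp only [truncField, hA]
    abel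
  have hM0 : 0 ≤ M := (norm_nonneg _).trans (hM (Real.sqrt 3) (right_mem_Icc.2 neg_sqrt_three_le))
  refine ⟨r, M + lam / 2, hr, by positivity, by positivity, fun u hu => ?_,
    fun z hz v w => ?_, fun z hz v w => ?_⟩
  · have he : ContinuousOn (fun z => u z - ubar z) Ixi := hu.sub hubar
    have hre : ContinuousOn (fun z => retract r (u z - ubar z)) Ixi :=
      (continuous_retract hr).comp_continuousOn he
    refine (hAc.clm_apply he).add (ContinuousOn.sub ?_ (hAc.clm_apply hre))
    exact hF.comp ((hubar.add hre).prodMk continuousOn_id) fun z hz => ⟨mem_univ _, hz⟩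
  · rw [hsub, inner_add_left]
    have h1 := hdef z hz (v - w)
    have h2 := hrem z hz (v - ubar z) (w - ubar z)
    rw [sub_sub_sub_cancel_right] at h2
    have h3 := (neg_le_of_abs_le (abs_real_inner_le_norm
      ((F (ubar z + retract r (v - ubar z)) z - A z (retract r (v - ubar z))) -
        (F (ubar z + retract r (w - ubar z)) z - A z (retract r (w - ubar z)))) (v - w)))
    have h4 := mul_le_mul_of_nonneg_right h2 (norm_nonneg (v - w))
    nlinarith
  · rw [hsub]
    refine (norm_add_le _ _).trans ?_
    have h2 := hrem z hz (v - ubar z) (w - ubar z)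
    rw [sub_sub_sub_cancel_right] at h2
    have h3 := (A z).le_of_opNorm_le (hM z hz) (v - w)
    linarith

/-! ### Localization of discrete zeros -/

/-- Every discrete zero of a field that is strongly monotone in a tube of radius `r` and radially
coercive, with relative growth bound, outside of it, lies in the tube, once `p` is a good enough
approximation of the root in the Galerkin space. The residual of `u` is tested against `u - p`;
inside the tube this controls `‖u - ubar‖²`, outside of it `‖u - ubar‖`, and the inverse
inequality turns the resulting integral bound into a bound for the maximum of `‖u - p‖`. -/
lemma norm_sub_le_of_isDiscreteZero {F : State n → ℝ → State n}
    (hF : ContinuousOn (fun p : State n × ℝ => F p.1 p.2) (univ ×ˢ Ixi))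
    {ubar : ℝ → State n} (hubar : ContinuousOn ubar Ixi) (hzero : ∀ z ∈ Ixi, F (ubar z) z = 0)
    {r c L : ℝ} (hr : 0 < r) (hL : 0 < L) (hH : IsMonotoneField (truncField F ubar r) c L)
    {m C : ℝ} (hm : 0 < m) (hC : 0 < C)
    (hfar : ∀ z ∈ Ixi, ∀ u, r ≤ ‖u - ubar z‖ →
      m * ‖u - ubar z‖ ≤ inner ℝ (F u z) (u - ubar z) ∧
        ‖F u z‖ ≤ C * inner ℝ (F u z) (u - ubar z)) :
    ∃ δ : ℝ, 0 < δ ∧ ∀ N : ℕ, ∀ p ∈ polySpace n N,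
      (∀ z ∈ Ixi, ‖p z - ubar z‖ ≤ δ) →
      ((N : ℝ) + 1) ^ 2 * ∫ z, ‖p z - ubar z‖ ^ 2 ∂nuXi ≤ δ →
      ∀ u, IsDiscreteZero F N u → ∀ z ∈ Ixi, ‖u z - ubar z‖ ≤ r := by
  have hc := hH.pos
  set K := L ^ 2 / (2 * c) with hK
  have hKpos : 0 < K := by positivity
  set a₀ := 4 / c * K + 2 with ha₀
  set b₀ := 4 / m * K with hb₀
  have ha₀pos : 0 < a₀ := by positivity
  have hb₀pos : 0 < b₀ := by positivity
  -- the first bound keeps `p` inside the tube, the second absorbs the far part of the residual,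
  -- the third closes the quadratic inequality for the maximum of `‖u - p‖`
  set δ := min (min (r / 2) (1 / (2 * C))) (r / 2 / (2 * (a₀ * (2 / r) + b₀) * 2)) with hδ
  have hδpos : 0 < δ := by positivity
  refine ⟨δ, hδpos, fun N p hp hpsup hpL2 u hu => ?_⟩
  have hpc := (continuous_of_mem_polySpace hp).continuousOn (s := Ixi)
  have huc := (continuous_of_mem_polySpace hu.1).continuousOn (s := Ixi)
  have hFu : ContinuousOn (fun z => F (u z) z) Ixi :=
    hF.comp (huc.prodMk continuousOn_id) fun z hz => ⟨mem_univ _, hz⟩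
  have hδr : δ ≤ r / 2 := (min_le_left _ _).trans (min_le_left _ _)
  have hδC : δ * C ≤ 1 / 2 := by
    have : δ ≤ 1 / (2 * C) := (min_le_left _ _).trans (min_le_right _ _)
    calc δ * C ≤ 1 / (2 * C) * C := by gcongr
      _ = 1 / 2 := by field_simp
  obtain ⟨y, hy, hmax⟩ := (isCompact_Icc : IsCompact Ixi).exists_isMaxOn
    ⟨Real.sqrt 3, right_mem_Icc.2 neg_sqrt_three_le⟩ (huc.sub hpc).norm
  set M := ‖u y - p y‖ with hM
  have hM0 : 0 ≤ M := norm_nonneg _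
  have hmaxM : ∀ z ∈ Ixi, ‖u z - p z‖ ≤ M := fun z hz => hmax hz
  -- the integrand of the tested residual, shifted to be nonnegative
  set Q : ℝ → ℝ := fun z => inner ℝ (F (u z) z) ((u - p) z) + K * ‖p z - ubar z‖ ^ 2 with hQ
  have hpoint : ∀ z ∈ Ixi,
      ‖u z - p z‖ ^ 2 ≤ (4 / c + 4 * M / m) * Q z + 2 * ‖p z - ubar z‖ ^ 2 := by
    intro z hz
    set e := u z - ubar z with he
    set d := p z - ubar z with hd
    have hq : u z - p z = e - d := by rw [he, hd]; abel
    have hQz : Q z = inner ℝ (F (u z) z) e - inner ℝ (F (u z) z) d + K * ‖d‖ ^ 2 := by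
      rw [← inner_sub_right, ← hq]; rfl
    have hFd := real_inner_le_norm (F (u z) z) d
    have hdδ : ‖d‖ ≤ δ := hpsup z hz
    rcases le_or_gt r ‖e‖ with hfar' | hnear
    · obtain ⟨h1, h2⟩ := hfar z hz (u z) hfar'
      have hpos : 0 ≤ inner ℝ (F (u z) z) e := le_trans (by positivity) h1
      have h3 : ‖F (u z) z‖ * ‖d‖ ≤ 1 / 2 * inner ℝ (F (u z) z) e := by
        calc ‖F (u z) z‖ * ‖d‖ ≤ (C * inner ℝ (F (u z) z) e) * δ := by gcongr
          _ = (δ * C) * inner ℝ (F (u z) z) e := by ring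
          _ ≤ _ := by gcongr
      have h4 : m / 2 * ‖e‖ ≤ Q z := by
        have : 0 ≤ K * ‖d‖ ^ 2 := by positivity
        rw [hQz]; linarith
      have hQ0 : 0 ≤ Q z := le_trans (by positivity) h4
      have h5 : ‖e - d‖ ≤ 2 * ‖e‖ := (norm_sub_le _ _).trans (by linarith)
      have h6 : ‖e - d‖ ^ 2 ≤ M * (2 * ‖e‖) := by
        rw [pow_two]
        have := hmaxM z hz
        rw [hq] at this
        gcongr
      have h7 : 2 * ‖e‖ ≤ 4 / m * Q z := by
        calc 2 * ‖e‖ = 4 / m * (m / 2 * ‖e‖) := by field_simp; ring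
          _ ≤ _ := by gcongr
      rw [hq]
      calc ‖e - d‖ ^ 2 ≤ M * (4 / m * Q z) := h6.trans (by gcongr)
        _ = 4 * M / m * Q z := by ring
        _ ≤ _ := by
          have : 0 ≤ 4 / c * Q z := by positivity
          have : 0 ≤ 2 * ‖d‖ ^ 2 := by positivity
          linarith
    · have hT := truncField_of_norm_le (F := F) hr hnear.le
      have hT0 : truncField F ubar r (ubar z) z = 0 := by
        rw [truncField_of_norm_le hr (by simpa using hr.le), hzero z hz]
      have h1 := hH.monotone z hz (u z) (ubar z)
      have h2 := hH.lipschitz z hz (u z) (ubar z)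
      rw [hT, hT0, sub_zero] at h1 h2
      have h3 : ‖F (u z) z‖ * ‖d‖ ≤ L * ‖e‖ * ‖d‖ := by gcongr
      have h4 : c / 2 * ‖e‖ ^ 2 ≤ Q z := by
        have h5 : K * ‖d‖ ^ 2 + c / 2 * ‖e‖ ^ 2 - L * ‖e‖ * ‖d‖ =
            (2 * c)⁻¹ * (L * ‖d‖ - c * ‖e‖) ^ 2 := by
          rw [hK]; field_simp; ring
        have h6 : 0 ≤ (2 * c)⁻¹ * (L * ‖d‖ - c * ‖e‖) ^ 2 := by positivity
        rw [hQz]; linarith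
      have hQ0 : 0 ≤ Q z := le_trans (by positivity) h4
      have h5 : ‖e - d‖ ^ 2 ≤ 2 * ‖e‖ ^ 2 + 2 * ‖d‖ ^ 2 := by
        have h6 := norm_sub_le e d
        have h7 : ‖e - d‖ ^ 2 ≤ (‖e‖ + ‖d‖) ^ 2 := by gcongr
        nlinarith [sq_nonneg (‖e‖ - ‖d‖)]
      have h7 : 2 * ‖e‖ ^ 2 ≤ 4 / c * Q z := by
        calc 2 * ‖e‖ ^ 2 = 4 / c * (c / 2 * ‖e‖ ^ 2) := by field_simp; ring
          _ ≤ _ := by gcongr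
      have h8 : 0 ≤ 4 * M / m * Q z := by positivity
      rw [hq]
      linarith
  have hQc1 : ContinuousOn (fun z => (inner ℝ (F (u z) z) ((u - p) z) : ℝ)) Ixi :=
    hFu.inner (huc.sub hpc)
  have hQint : ∫ z, Q z ∂nuXi = K * ∫ z, ‖p z - ubar z‖ ^ 2 ∂nuXi := by
    rw [hQ, integral_add (integrable_nuXi hQc1) (integrable_nuXi (by fun_prop)),
      hu.2 _ (Submodule.sub_mem _ hu.1 hp), zero_add, integral_const_mul]
  have hQc : ContinuousOn Q Ixi := hQc1.add (by fun_prop)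
  set α := ∫ z, ‖p z - ubar z‖ ^ 2 ∂nuXi with hα
  have hint : ∫ z, ‖(u - p) z‖ ^ 2 ∂nuXi ≤ (a₀ + b₀ * M) * α := by
    have h1 := integral_nuXi_mono (F := fun z => ‖(u - p) z‖ ^ 2)
      ((huc.sub hpc).norm.pow 2) (by fun_prop) hpoint
    rw [integral_add (integrable_nuXi (by fun_prop)) (integrable_nuXi (by fun_prop)),
      integral_const_mul, integral_const_mul, hQint] at h1
    refine h1.trans (le_of_eq ?_)
    rw [ha₀, hb₀]; ring
  have hinv := norm_sq_le_of_mem_polySpace (Submodule.sub_mem _ hu.1 hp) hy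
  have hM2 : M ^ 2 ≤ 2 * δ * (a₀ + b₀ * M) := by
    calc M ^ 2 ≤ 2 * ((N : ℝ) + 1) ^ 2 * ((a₀ + b₀ * M) * α) := by
          refine hinv.trans ?_
          gcongr
      _ = 2 * (((N : ℝ) + 1) ^ 2 * α) * (a₀ + b₀ * M) := by ring
      _ ≤ _ := by gcongr
  have hMr : M ≤ r / 2 := by
    by_contra hcon
    rw [not_le] at hcon
    have hMpos : 0 < M := lt_trans (by positivity) hcon
    have h1 : δ ≤ r / 2 / (2 * (a₀ * (2 / r) + b₀) * 2) := min_le_right _ _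
    have h2 : a₀ + b₀ * M ≤ (a₀ * (2 / r) + b₀) * M := by
      have : a₀ ≤ a₀ * (2 / r) * M := by
        have h3 : 1 ≤ 2 / r * M := by
          rw [div_mul_eq_mul_div, le_div_iff₀ hr]; linarith
        calc a₀ = a₀ * 1 := by ring
          _ ≤ a₀ * (2 / r * M) := by gcongr
          _ = _ := by ring
      linarith
    have h3 : M ^ 2 ≤ r / 4 * M := by
      calc M ^ 2 ≤ 2 * δ * ((a₀ * (2 / r) + b₀) * M) := hM2.trans (by gcongr)
        _ ≤ 2 * (r / 2 / (2 * (a₀ * (2 / r) + b₀) * 2)) * ((a₀ * (2 / r) + b₀) * M) := by gcongr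
        _ = r / 4 * M := by
          have : a₀ * (2 / r) + b₀ ≠ 0 := by positivity
          generalize a₀ * (2 / r) + b₀ = s at *
          field_simp
          ring
    have h4 : M ≤ r / 4 := by
      rw [pow_two] at h3
      exact le_of_mul_le_mul_right h3 hMpos
    linarith
  intro z hz
  calc ‖u z - ubar z‖ = ‖(u z - p z) + (p z - ubar z)‖ := by congr 1; abel
    _ ≤ ‖u z - p z‖ + ‖p z - ubar z‖ := norm_add_le _ _
    _ ≤ r / 2 + r / 2 := add_le_add ((hmaxM z hz).trans hMr) ((hpsup z hz).trans hδr)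
    _ = r := by ring

/-- Existence and uniqueness of discrete zeros for the Euclidean inner product and an outward
field, given polynomial approximations of the root with uniformly small error and `L²` error of
order `o(1 / N)`. -/
theorem exists_forall_existsUnique_isDiscreteZero {F : State n → ℝ → State n}
    (hF : ContinuousOn (fun p : State n × ℝ => F p.1 p.2) (univ ×ˢ Ixi))
    (hdiff : ∀ z ∈ Ixi, Differentiable ℝ fun u => F u z)
    (hjac : ContinuousOn (fun p : State n × ℝ => jac F p.1 p.2) (univ ×ˢ Ixi))
    {ubar : ℝ → State n} (hubar : ContinuousOn ubar Ixi) (hzero : ∀ z ∈ Ixi, F (ubar z) z = 0)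
    (happrox : ∀ ε : ℝ, 0 < ε → ∃ N₀ : ℕ, ∀ N ≥ N₀, ∃ p ∈ polySpace n N,
      (∀ z ∈ Ixi, ‖p z - ubar z‖ ≤ ε) ∧
        ((N : ℝ) + 1) ^ 2 * ∫ z, ‖p z - ubar z‖ ^ 2 ∂nuXi ≤ ε)
    {lam : ℝ} (hlam : 0 < lam)
    (hdef : ∀ z ∈ Ixi, ∀ w, lam * ‖w‖ ^ 2 ≤ inner ℝ (jac F (ubar z) z w) w)
    (hfar : ∀ ρ : ℝ, 0 < ρ → ∃ m C : ℝ, 0 < m ∧ 0 < C ∧ ∀ z ∈ Ixi, ∀ u, ρ ≤ ‖u - ubar z‖ →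
      m * ‖u - ubar z‖ ≤ inner ℝ (F u z) (u - ubar z) ∧
        ‖F u z‖ ≤ C * inner ℝ (F u z) (u - ubar z)) :
    ∃ Nbar : ℕ, ∀ N ≥ Nbar, ∃! u, IsDiscreteZero F N u := by
  obtain ⟨r, L, hr, hL, hH⟩ :=
    exists_isMonotoneField_truncField hF hdiff hjac hubar hlam hdef
  obtain ⟨m, C, hm, hC, hmC⟩ := hfar r hr
  obtain ⟨δ, hδ, hloc⟩ := norm_sub_le_of_isDiscreteZero hF hubar hzero hr hL hH hm hC hmC
  set κ := L ^ 2 / (lam / 2) ^ 2 with hκ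
  have hκpos : 0 < κ := by positivity
  obtain ⟨N₀, hN₀⟩ := happrox (min δ (min (r / 2) ((r / 2) ^ 2 / (2 * κ)))) (by positivity)
  refine ⟨N₀, fun N hN => ?_⟩
  obtain ⟨p, hp, hpsup, hpL2⟩ := hN₀ N hN
  have hT0 : ∀ z ∈ Ixi, truncField F ubar r (ubar z) z = 0 := fun z hz => by
    rw [truncField_of_norm_le hr (by simpa using hr.le), hzero z hz]
  -- in the tube, the discrete zeros of the field and of its truncation agree
  have hiff : ∀ u, (∀ z ∈ Ixi, ‖u z - ubar z‖ ≤ r) →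
      (IsDiscreteZero F N u ↔ IsDiscreteZero (truncField F ubar r) N u) := by
    intro u hu
    refine and_congr_right fun _ => forall₂_congr fun v _ => ?_
    rw [integral_nuXi_congr fun z hz =>
      congrArg (fun w => inner ℝ w (v z)) (truncField_of_norm_le (F := F) hr (hu z hz)).symm]
  obtain ⟨u, hu⟩ := hH.exists_isDiscreteZero N
  have hutube : ∀ z ∈ Ixi, ‖u z - ubar z‖ ≤ r := by
    intro z hz
    have h1 := hH.integral_norm_sub_sq_le hubar hT0 hu hp
    have h2 := norm_sq_le_of_mem_polySpace (Submodule.sub_mem _ hu.1 hp) hz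
    have h3 : ((N : ℝ) + 1) ^ 2 * ∫ z, ‖p z - ubar z‖ ^ 2 ∂nuXi ≤ (r / 2) ^ 2 / (2 * κ) :=
      hpL2.trans ((min_le_right _ _).trans (min_le_right _ _))
    have h4 : ‖(u - p) z‖ ^ 2 ≤ (r / 2) ^ 2 := by
      calc ‖(u - p) z‖ ^ 2 ≤ 2 * ((N : ℝ) + 1) ^ 2 *
            (κ * ∫ z, ‖p z - ubar z‖ ^ 2 ∂nuXi) := h2.trans (by gcongr; exact h1)
        _ = 2 * κ * (((N : ℝ) + 1) ^ 2 * ∫ z, ‖p z - ubar z‖ ^ 2 ∂nuXi) := by ring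
        _ ≤ 2 * κ * ((r / 2) ^ 2 / (2 * κ)) := by gcongr
        _ = (r / 2) ^ 2 := by field_simp
    have h5 : ‖u z - p z‖ ≤ r / 2 := (abs_le_of_sq_le_sq' h4 (by positivity)).2
    have h6 : ‖p z - ubar z‖ ≤ r / 2 :=
      (hpsup z hz).trans ((min_le_right _ _).trans (min_le_left _ _))
    calc ‖u z - ubar z‖ = ‖(u z - p z) + (p z - ubar z)‖ := by congr 1; abel
      _ ≤ ‖u z - p z‖ + ‖p z - ubar z‖ := norm_add_le _ _
      _ ≤ r := by linarith
  refine ⟨u, (hiff u hutube).2 hu, fun v hv => ?_⟩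
  have hvtube := hloc N p hp (fun z hz => (hpsup z hz).trans (min_le_left _ _))
    (hpL2.trans (min_le_left _ _)) v hv
  exact hH.eq_of_isDiscreteZero ((hiff v hvtube).1 hv) hu

/-! ### Approximation in the Galerkin space -/

lemma exists_mem_polySpace_approx {u g : ℝ → State n}
    (hg : MemLp g 2 (volume.restrict (Ioo (-Real.sqrt 3) (Real.sqrt 3))))
    (huc : ContinuousOn u Ixi)
    (hu : ∀ x ∈ Ixi, u x - u (-Real.sqrt 3) = ∫ z in (-Real.sqrt 3)..x, g z)
    {ε : ℝ} (hε : 0 < ε) :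
    ∃ N₀ : ℕ, ∀ N ≥ N₀, ∃ p ∈ polySpace n N, (∀ z ∈ Ixi, ‖p z - u z‖ ≤ ε) ∧
      ((N : ℝ) + 1) ^ 2 * ∫ z, ‖p z - u z‖ ^ 2 ∂nuXi ≤ ε := by
  have hS := sqrt_three_pos
  have hS1 : 1 ≤ Real.sqrt 3 := Real.one_le_sqrt.2 (by norm_num)
  set η : ℝ := min 1 (min ε (ε ^ 2)) / (2 * n + 1) with hη
  have hηpos : 0 < η := by positivity
  have hηle : (2 * (n : ℝ) + 1) * η = min 1 (min ε (ε ^ 2)) := by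
    rw [hη]; field_simp
  have hη1 : η ≤ 1 := by
    rw [hη, div_le_one (by positivity)]
    refine (min_le_left _ _).trans ?_
    have : (0 : ℝ) ≤ n := by positivity
    linarith
  have hgI : IntegrableOn g (Ioo (-Real.sqrt 3) (Real.sqrt 3)) := hg.integrable (by norm_num)
  have hcomp : ∀ i : Fin n, ∃ N₀ : ℕ, ∀ N ≥ N₀, ∃ p : ℝ[X], p.natDegree ≤ N + 1 ∧
      (∀ x ∈ Ixi, |u x i - p.eval x| ≤ η) ∧
      ((N : ℝ) + 1) ^ 2 * ∫ x in (-Real.sqrt 3)..(Real.sqrt 3), (u x i - p.eval x) ^ 2 ≤ η := by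
    intro i
    refine exists_polynomial_approx (u := fun x => u x i) (g := fun x => g x i)
      ((EuclideanSpace.proj (𝕜 := ℝ) i).comp_memLp' hg) (fun x hx => ?_) hηpos
    have h1 : IntervalIntegrable g volume (-Real.sqrt 3) x := by
      rw [intervalIntegrable_iff_integrableOn_Ioo_of_le hx.1]
      exact hgI.mono_set (Ioo_subset_Ioo_right hx.2)
    have h2 := (EuclideanSpace.proj (𝕜 := ℝ) i).intervalIntegral_comp_comm h1
    have h3 := congrArg (fun v : State n => v i) (hu x hx)
    simp only [PiLp.sub_apply] at h3
    rw [h3]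
    exact h2.symm
  choose N₀ hN₀ using hcomp
  refine ⟨(Finset.univ.sup N₀) + 1, fun N hN => ?_⟩
  obtain ⟨N, rfl⟩ : ∃ N', N = N' + 1 := ⟨N - 1, by omega⟩
  have hNi : ∀ i, N₀ i ≤ N := fun i =>
    (Finset.le_sup (f := N₀) (Finset.mem_univ i)).trans (by omega)
  choose p hp hpsup hpL2 using fun i => hN₀ i N (hNi i)
  have hmem : (fun z => WithLp.toLp 2 fun i => (p i).eval z : ℝ → State n) ∈
      polySpace n (N + 1) := mem_polySpace_iff.2 ⟨p, hp, fun z i => rfl⟩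
  refine ⟨_, hmem, fun z hz => ?_, ?_⟩
  · refine (abs_le_of_sq_le_sq' ?_ hε.le).2
    rw [EuclideanSpace.real_norm_sq_eq]
    calc ∑ i, ((WithLp.toLp 2 (fun i => (p i).eval z) - u z : State n) i) ^ 2
        ≤ ∑ _i : Fin n, η := by
          refine Finset.sum_le_sum fun i _ => ?_
          have h1 := hpsup i z hz
          have h2 : ((WithLp.toLp 2 (fun i => (p i).eval z) - u z : State n) i) ^ 2 =
              |u z i - (p i).eval z| ^ 2 := by
            rw [sq_abs, PiLp.sub_apply]; ring
          rw [h2]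
          calc |u z i - (p i).eval z| ^ 2 ≤ η ^ 2 := by gcongr
            _ ≤ η := by nlinarith
      _ = n * η := by simp
      _ ≤ (2 * (n : ℝ) + 1) * η := by
          have : 0 ≤ n * η := by positivity
          linarith
      _ ≤ ε ^ 2 := by rw [hηle]; exact (min_le_right _ _).trans (min_le_right _ _)
  · have hci : ∀ i, ContinuousOn (fun z => (u z i - (p i).eval z) ^ 2) Ixi := fun i =>
      (((EuclideanSpace.proj (𝕜 := ℝ) i).continuous.comp_continuousOn huc).sub
        (p i).continuous.continuousOn).pow 2
    have h1 : ∫ z, ‖(WithLp.toLp 2 (fun i => (p i).eval z) - u z : State n)‖ ^ 2 ∂nuXi =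
        ∑ i, ∫ z, (u z i - (p i).eval z) ^ 2 ∂nuXi := by
      rw [← integral_finsetSum _ fun i _ => integrable_nuXi (hci i)]
      refine integral_congr_ae (ae_of_all _ fun z => ?_)
      simp only [EuclideanSpace.real_norm_sq_eq, PiLp.sub_apply]
      exact Finset.sum_congr rfl fun i _ => by ring
    rw [h1, Finset.mul_sum]
    calc ∑ i, (((N + 1 : ℕ) : ℝ) + 1) ^ 2 * ∫ z, (u z i - (p i).eval z) ^ 2 ∂nuXi
        ≤ ∑ _i : Fin n, 2 * η := by
          refine Finset.sum_le_sum fun i _ => ?_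
          have h2 := hpL2 i
          rw [integral_nuXi]
          set J := ∫ x in (-Real.sqrt 3)..(Real.sqrt 3), (u x i - (p i).eval x) ^ 2 with hJ
          have hJ0 : 0 ≤ J :=
            intervalIntegral.integral_nonneg neg_sqrt_three_le fun z _ => sq_nonneg _
          have h3 : (((N + 1 : ℕ) : ℝ) + 1) ^ 2 ≤ 4 * ((N : ℝ) + 1) ^ 2 := by
            push_cast
            have : (0 : ℝ) ≤ N := by positivity
            nlinarith
          have h4 : (2 * Real.sqrt 3)⁻¹ ≤ 1 / 2 := by
            rw [one_div]
            exact inv_anti₀ (by norm_num) (by linarith)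
          calc _ ≤ (4 * ((N : ℝ) + 1) ^ 2) * (1 / 2 * J) := by gcongr
            _ = 2 * (((N : ℝ) + 1) ^ 2 * J) := by ring
            _ ≤ 2 * η := by gcongr
      _ = 2 * n * η := by simp; ring
      _ ≤ (2 * (n : ℝ) + 1) * η := by linarith
      _ ≤ ε := by rw [hηle]; exact (min_le_right _ _).trans (min_le_left _ _)

/-! ### Reduction to the Euclidean inner product -/

/-- A square root of the weight turns the weighted inner product into the Euclidean one. -/
lemma exists_equiv_inner_eq_pInner {P : Matrix (Fin n) (Fin n) ℝ} (hP : P.PosDef) :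
    ∃ B : State n ≃L[ℝ] State n, ∀ v w, inner ℝ (B v) (B w) = pInner P v w := by
  obtain ⟨M, hM⟩ : ∃ M : Matrix (Fin n) (Fin n) ℝ, P = Mᴴ * M := by
    open scoped MatrixOrder in
    exact CStarAlgebra.nonneg_iff_eq_star_mul_self.1 hP.posSemidef.nonneg
  set T : State n →ₗ[ℝ] State n := Matrix.toEuclideanLin M with hT
  have hTi : ∀ v w, inner ℝ (T v) (T w) = pInner P v w := by
    intro v w
    rw [EuclideanSpace.inner_eq_star_dotProduct, hT, pInner, hM]
    simp only [Matrix.toLpLin_apply, star_trivial,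
      Matrix.conjTranspose_eq_transpose_of_trivial]
    rw [← Matrix.mulVec_mulVec, Matrix.dotProduct_mulVec _ Mᵀ, Matrix.vecMul_transpose,
      dotProduct_comm]
  have hinj : Function.Injective T := by
    rw [← LinearMap.ker_eq_bot, LinearMap.ker_eq_bot']
    intro v hv
    by_contra hne
    have h1 := hTi v v
    rw [hv, inner_zero_left, pInner] at h1
    have h2 := hP.dotProduct_mulVec_pos (x := v.ofLp) (by simpa using hne)
    rw [star_trivial] at h2
    linarith
  exact ⟨(LinearEquiv.ofInjectiveEndo T hinj).toContinuousLinearEquiv, fun v w => hTi v w⟩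

lemma param_mem_Icc {a b : ℝ} (hab : a < b) {z : ℝ} (hz : z ∈ Ixi) : param a b z ∈ Icc a b := by
  have hS := sqrt_three_pos
  have h1 : 0 ≤ std a b := div_nonneg (by linarith) (by positivity)
  have h2 : std a b * Real.sqrt 3 = (b - a) / 2 := by rw [std]; field_simp
  have h3 := mul_le_mul_of_nonneg_left hz.1 h1
  have h4 := mul_le_mul_of_nonneg_left hz.2 h1
  rw [param, mean]
  constructor <;> linarith

lemma continuous_param (a b : ℝ) : Continuous (param a b) := by
  unfold param; fun_prop

/-- The field `ε B f(B⁻¹ y, μ̄ + σ z)`, obtained from `f` by the change of unknown `y = B u`. -/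
noncomputable def transformedField (f : State n → ℝ → State n) (a b ε : ℝ)
    (B : State n ≃L[ℝ] State n) (y : State n) (z : ℝ) : State n :=
  ε • B (f (B.symm y) (param a b z))

lemma isDiscreteZero_transformedField_iff {f : State n → ℝ → State n} {a b ε : ℝ} (hε : ε ≠ 0)
    (B : State n ≃L[ℝ] State n) {N : ℕ} {u : ℝ → State n} :
    IsDiscreteZero (transformedField f a b ε B) N (fun z => B (u z)) ↔
      IsGalerkinSolution f a b N u := by
  set T := (B : State n →L[ℝ] State n) with hT
  set T' := (B.symm : State n →L[ℝ] State n) with hT'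
  have hadj : ∀ v, T.adjoint (T'.adjoint v) = v := fun v => by
    rw [← ContinuousLinearMap.comp_apply, ← ContinuousLinearMap.adjoint_comp]
    have : T' ∘L T = ContinuousLinearMap.id ℝ (State n) := by ext1 x; simp [hT, hT']
    rw [this, ContinuousLinearMap.adjoint_id, ContinuousLinearMap.id_apply]
  have hint : ∀ v : ℝ → State n,
      ∫ z, inner ℝ (transformedField f a b ε B (B (u z)) z) (v z) ∂nuXi =
        ε * ∫ z, inner ℝ (f (u z) (param a b z)) (T.adjoint (v z)) ∂nuXi := by
    intro v
    rw [← integral_const_mul]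
    refine integral_congr_ae (ae_of_all _ fun z => ?_)
    simp only [transformedField, ContinuousLinearEquiv.symm_apply_apply, inner_smul_left,
      ContinuousLinearMap.adjoint_inner_right, conj_trivial]
    rfl
  constructor
  · rintro ⟨h1, h2⟩
    refine ⟨?_, fun v hv => ?_⟩
    · simpa [hT'] using comp_mem_polySpace T' h1
    · have h3 := h2 _ (comp_mem_polySpace T'.adjoint hv)
      rw [hint, mul_eq_zero, or_iff_right hε] at h3
      simpa only [hadj] using h3
  · rintro ⟨h1, h2⟩
    refine ⟨comp_mem_polySpace T h1, fun v hv => ?_⟩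
    rw [hint, h2 _ (comp_mem_polySpace T.adjoint hv), mul_zero]

lemma hasFDerivAt_transformedField {f : State n → ℝ → State n} {a b ε : ℝ}
    (B : State n ≃L[ℝ] State n) {y : State n} {z : ℝ}
    (h : DifferentiableAt ℝ (fun u => f u (param a b z)) (B.symm y)) :
    HasFDerivAt (fun y => transformedField f a b ε B y z)
      (ε • ((B : State n →L[ℝ] State n) ∘L (jac f (B.symm y) (param a b z) ∘L
        (B.symm : State n →L[ℝ] State n)))) y :=
  (((B : State n →L[ℝ] State n).hasFDerivAt.comp y
    (h.hasFDerivAt.comp y (B.symm : State n →L[ℝ] State n).hasFDerivAt))).const_smul ε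

end PCE

open PCE in
theorem mainTheorem2 {n : ℕ} {a b : ℝ} (hab : a < b)
    -- the vector field, continuous on `ℝⁿ × [a, b]` and continuously differentiable in `u`
    (f : PCE.State n → ℝ → PCE.State n)
    (hf : ContinuousOn (fun p : PCE.State n × ℝ => f p.1 p.2) (Set.univ ×ˢ Set.Icc a b))
    (hdiff : ∀ μ ∈ Set.Icc a b, Differentiable ℝ (fun u => f u μ))
    (hjac : ContinuousOn (fun p : PCE.State n × ℝ => PCE.jac f p.1 p.2)
      (Set.univ ×ˢ Set.Icc a b))
    -- the unique branch, and its re-parametrization of class `H^s`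
    (uStar : ℝ → PCE.State n) (huStar : PCE.IsUniqueBranch f a b uStar)
    (ubar : ℝ → PCE.State n) (hubar : ∀ z ∈ PCE.Ixi, ubar z = uStar (PCE.param a b z))
    {s : ℝ} (hs : 1 < s) (hHs : PCE.MemHs (-Real.sqrt 3) (Real.sqrt 3) s ubar)
    -- the weight
    (P : Matrix (Fin n) (Fin n) ℝ) (hP : P.PosDef)
    -- `ε = 1`: outward field and positive definiteness; `ε = -1`: all inequalities reversed
    (ε : ℝ) (hε : ε = 1 ∨ ε = -1)
    -- uniform definiteness of the Jacobian at the root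
    (lam : ℝ) (hlam : 0 < lam)
    (hdef : ∀ z ∈ PCE.Ixi, ∀ w : PCE.State n,
      lam * PCE.pNorm P w ^ 2 ≤
        ε * PCE.pInner P (PCE.jac f (ubar z) (PCE.param a b z) w) w)
    -- uniform radial coercivity and relative growth bound away from the root
    (hfar : ∀ ρ : ℝ, 0 < ρ → ∃ m C : ℝ, 0 < m ∧ 0 < C ∧
      ∀ z ∈ PCE.Ixi, ∀ u : PCE.State n, ρ ≤ PCE.pNorm P (u - ubar z) →
        m * PCE.pNorm P (u - ubar z) ≤
            ε * PCE.pInner P (f u (PCE.param a b z)) (u - ubar z) ∧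
          PCE.pNorm P (f u (PCE.param a b z)) ≤
            C * (ε * PCE.pInner P (f u (PCE.param a b z)) (u - ubar z))) :
    ∃ Nbar : ℕ, ∀ N : ℕ, Nbar ≤ N →
      ∃! u : ℝ → PCE.State n, PCE.IsGalerkinSolution f a b N u := by
  have hε0 : ε ≠ 0 := by rcases hε with rfl | rfl <;> norm_num
  have hεabs : |ε| = 1 := by rcases hε with rfl | rfl <;> simp
  have hparam : MapsTo (param a b) Ixi (Icc a b) := fun z hz => param_mem_Icc hab hz
  have hubarc : ContinuousOn ubar Ixi :=
    (huStar.1.1.comp (continuous_param a b).continuousOn hparam).congr hubar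
  obtain ⟨B, hB⟩ := exists_equiv_inner_eq_pInner hP
  have hBn : ∀ v, pNorm P v = ‖B v‖ := fun v => by
    rw [pNorm, ← hB, real_inner_self_eq_norm_sq, Real.sqrt_sq (norm_nonneg _)]
  set F := transformedField f a b ε B with hF
  have hBub : ContinuousOn (fun z => B (ubar z)) Ixi := B.continuous.comp_continuousOn hubarc
  have hpair : ContinuousOn (fun p : State n × ℝ => (B.symm p.1, param a b p.2))
      (univ ×ˢ Ixi) := by
    have := continuous_param a b
    fun_prop
  have hmaps : MapsTo (fun p : State n × ℝ => (B.symm p.1, param a b p.2)) (univ ×ˢ Ixi)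
      (univ ×ˢ Icc a b) := fun p hp => ⟨mem_univ _, hparam hp.2⟩
  have hFd : ∀ z ∈ Ixi, ∀ y, HasFDerivAt (fun y => F y z)
      (ε • ((B : State n →L[ℝ] State n) ∘L (jac f (B.symm y) (param a b z) ∘L
        (B.symm : State n →L[ℝ] State n)))) y := fun z hz y =>
    hasFDerivAt_transformedField B (hdiff _ (hparam hz) _)
  have hdist : ∀ (u : State n) z, u - B (ubar z) = B (B.symm u - ubar z) := fun u z => by
    rw [map_sub, B.apply_symm_apply]
  have hinner : ∀ (u : State n) z, inner ℝ (F u z) (u - B (ubar z)) =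
      ε * pInner P (f (B.symm u) (param a b z)) (B.symm u - ubar z) := fun u z => by
    rw [hdist, hF, transformedField, real_inner_smul_left, hB]
  have key := exists_forall_existsUnique_isDiscreteZero (F := F) (ubar := fun z => B (ubar z))
    ?_ (fun z hz y => (hFd z hz y).differentiableAt) ?_ hBub ?_ ?_ hlam ?_ ?_
  · obtain ⟨Nbar, hN⟩ := key
    refine ⟨Nbar, fun N hNN => ?_⟩
    obtain ⟨y, hy, huniq⟩ := hN N hNN
    refine ⟨fun z => B.symm (y z), ?_, fun v hv => ?_⟩
    · refine (isDiscreteZero_transformedField_iff hε0 B).1 ?_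
      simpa only [B.apply_symm_apply] using hy
    · have := huniq _ ((isDiscreteZero_transformedField_iff hε0 B).2 hv)
      ext1 z
      rw [← this, B.symm_apply_apply]
  · exact (B.continuous.comp_continuousOn (hf.comp hpair hmaps)).const_smul ε
  · have h1 : ContinuousOn (fun p : State n × ℝ =>
        ε • ((B : State n →L[ℝ] State n) ∘L (jac f (B.symm p.1) (param a b p.2) ∘L
          (B.symm : State n →L[ℝ] State n)))) (univ ×ˢ Ixi) :=
      (continuousOn_const.clm_comp
        ((hjac.comp hpair hmaps).clm_comp continuousOn_const)).const_smul ε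
    exact h1.congr fun p hp => (hFd p.2 hp.2 p.1).fderiv
  · intro z hz
    rw [hF, transformedField, B.symm_apply_apply, hubar z hz, huStar.1.2 _ (hparam hz), map_zero,
      smul_zero]
  · intro η hη
    obtain ⟨-, D, hD, -⟩ := hHs
    obtain ⟨hweak, hL2⟩ := hD 1 (Nat.one_le_floor_iff _ |>.2 hs.le)
    have hprim : ∀ x ∈ Ixi, ubar x - ubar (-Real.sqrt 3) = ∫ z in (-Real.sqrt 3)..x, D 1 z :=
      fun x hx => hweak.sub_eq_integral (by linarith [sqrt_three_pos]) hubarc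
        (hL2.integrable (by norm_num)) hx
    set M := ‖(B : State n →L[ℝ] State n)‖ + 1 with hM
    have hM1 : 1 ≤ M := by linarith [norm_nonneg (B : State n →L[ℝ] State n)]
    have hM0 : 0 < M := by linarith
    have hBle : ∀ v, ‖B v‖ ≤ M * ‖v‖ := fun v =>
      (B : State n →L[ℝ] State n).le_of_opNorm_le (by linarith) v
    obtain ⟨N₀, hN₀⟩ := exists_mem_polySpace_approx hL2 hubarc hprim
      (show 0 < η / M ^ 2 by positivity)
    refine ⟨N₀, fun N hN => ?_⟩
    obtain ⟨p, hp, hpsup, hpL2⟩ := hN₀ N hN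
    have hpc := (continuous_of_mem_polySpace hp).continuousOn (s := Ixi)
    refine ⟨_, comp_mem_polySpace (B : State n →L[ℝ] State n) hp, fun z hz => ?_, ?_⟩
    · change ‖B (p z) - B (ubar z)‖ ≤ η
      rw [← map_sub]
      calc _ ≤ M * ‖p z - ubar z‖ := hBle _
        _ ≤ M ^ 2 * (η / M ^ 2) := by
          have : M ≤ M ^ 2 := by nlinarith
          exact mul_le_mul this (hpsup z hz) (norm_nonneg _) (by positivity)
        _ = η := by field_simp
    · have h1 : ∫ z, ‖B (p z) - B (ubar z)‖ ^ 2 ∂nuXi ≤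
          ∫ z, M ^ 2 * ‖p z - ubar z‖ ^ 2 ∂nuXi := by
        refine integral_nuXi_mono
          (((B.continuous.comp_continuousOn hpc).sub hBub).norm.pow 2) (by fun_prop)
          fun z _ => ?_
        rw [← map_sub, ← mul_pow]
        exact pow_le_pow_left₀ (norm_nonneg _) (hBle _) 2
      rw [integral_const_mul] at h1
      calc _ ≤ ((N : ℝ) + 1) ^ 2 * (M ^ 2 * ∫ z, ‖p z - ubar z‖ ^ 2 ∂nuXi) :=
            mul_le_mul_of_nonneg_left h1 (by positivity)
        _ = M ^ 2 * (((N : ℝ) + 1) ^ 2 * ∫ z, ‖p z - ubar z‖ ^ 2 ∂nuXi) := by ring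
        _ ≤ M ^ 2 * (η / M ^ 2) := by gcongr
        _ = η := by field_simp
  · intro z hz w
    have h1 := hdef z hz (B.symm w)
    rw [hBn, B.apply_symm_apply, ← hB, B.apply_symm_apply] at h1
    have h2 : jac F (B (ubar z)) z = _ := (hFd z hz (B (ubar z))).fderiv
    rw [h2, B.symm_apply_apply]
    simpa [real_inner_smul_left] using h1
  · intro ρ hρ
    obtain ⟨m, C, hm, hC, h⟩ := hfar ρ hρ
    refine ⟨m, C, hm, hC, fun z hz u hu => ?_⟩
    have h1 := h z hz (B.symm u)
    rw [hBn, hBn, ← hdist] at h1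
    rw [hinner, hF, transformedField, norm_smul, Real.norm_eq_abs, hεabs, one_mul]
    exact h1 hu
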